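/- **Setting.** Fix $d, W\in\mathbb N$ and an ordered field $K$ of numbers. An instance consists of $n$ random variables $X=\{X_1,\dots,X_n\}$ with values in $\{0,\dots,d-1\}$ (binary variables: $d=2$), a probability distribution $\Pr$ on their joint assignments with values in $K$, a subset $Y\subseteq X$, a decomposition of $Y$ into disjoint components $Y_1,\dots,Y_k$ of $w\ge 1$ variables each (the width), where each component is listed in a fixed order, and a description of the distribution (an arbitrary data tree, made available to algorithms). For a partial assignment $e$ of the variables, $\Pr(e)$ is the sum of $\Pr(x)$ over all joint assignments $x$ of $X$ that agree with $e$; in particular $\Pr(y)=\sum_z\Pr(y,z)$ for an assignment $y$ of $Y$, where $z$ ranges over the assignments of $Z=X\setminus Y$. The decomposition is *marginally exchangeable* if $$\Pr(Y_1=a_1,\dots,Y_k=a_k)=\Pr(Y_1=a_{\pi(1)},\dots,Y_k=a_{\pi(k)})$$ for all $a_1,\dots,a_k\in\{0,\dots,d-1\}^w$ and all permutations $\pi$ of $\{1,\dots,k\}$. **Computation.** Algorithms are programs of a WHILE language whose data are binary trees with leaves that are empty or elements of $K$. They are built from the elementary operations (identity; constants: the empty tree, $0$, $1$; first and second subtree;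 test for being a number; $+,-,\times,/$, with $a/0=0$, and $\le$ on numbers) by pairing, composition, branching and while-loops. Each construct takes one unit of time in addition to the time of its parts; an elementary operation takes one unit, plus the height of its result if that is a number, plus, if it is arithmetic, the heights of its operands. The height is a function $h:K\to\mathbb N$ with $h(m)\le \mathrm{bitlength}(m)+1$ for $m\in\mathbb N$, $h(a+b)\le h(a)+h(b)+1$ and $h(ab)\le h(a)+h(b)+1$; examples are $K=\mathbb Q$ with the maximum of the bit lengths of numerator and denominator (bit cost), and $K=\mathbb R$ with $h=0$ (unit-cost real arithmetic). The input is the description of the distribution, the decomposition (variable indices in unary), and a partial assignment. **Theorem.** Let $\mathcal F$ be any set of instances (with $K,h,d$ fixed) whose given decompositions of $Y$ are marginally exchangeable and of width at most $W$. Suppose that there are a program and a polynomial $p$ such that, for every instance in $\mathcal F$ and every assignment $y$ of $Y$, the program computes $\Pr(y)=\sum_z\Pr(y,z)$ in time at most $p(n)$, where $n=|X|$. Then MPE inference and marginal inference over $Y$ take time polynomial in $|X|$ on $\mathcal F$. That is, there are programs $A,B$ and polynomials $q,r$ such that, for every instance in $\mathcal F$ and every assignment $e$ of values to a set of variables $E\subseteq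 Y$, 1. $A$ computes in time at most $q(n)$ an assignment $y$ of $Y$ that agrees with $e$ and maximizes $\Pr(y)$ among all assignments of $Y$ that agree with $e$; 2. $B$ computes $\Pr(e)$ in time at most $r(n)$. -/

import Mathlib

/-! ## Cost of arithmetic -/

/-- A size measure (height) for the numbers that programs handle: an arithmetic step on numbers is
charged by the heights of its operands and of its result.  The two standard choices are
`HeightFn.bit` (bit length of rationals: the logarithmic cost criterion) and `HeightFn.unit`
(every number has height `0`: unit-cost arithmetic, as on a real RAM). -/
structure HeightFn (K : Type*) [Field K] where
  ht : K → ℕ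
  ht_natCast_le : ∀ m : ℕ, ht (m : K) ≤ Nat.size m + 1
  ht_add_le : ∀ a b : K, ht (a + b) ≤ ht a + ht b + 1
  ht_mul_le : ∀ a b : K, ht (a * b) ≤ ht a + ht b + 1

/-- Unit-cost arithmetic. -/
def HeightFn.unit (K : Type*) [Field K] : HeightFn K where
  ht _ := 0
  ht_natCast_le _ := Nat.zero_le _
  ht_add_le _ _ := Nat.zero_le _
  ht_mul_le _ _ := Nat.zero_le _

theorem HeightFn.size_le_of_eq_div {q : ℚ} {z : ℤ} {m m' T : ℕ}
    (hq : q = Rat.divInt z ((m : ℤ) * (m' : ℤ))) (hm : (m : ℤ) ≠ 0) (hm' : (m' : ℤ) ≠ 0)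
    (hz : z.natAbs < 2 ^ T) (hmT : m * m' < 2 ^ T) :
    max (Nat.size q.num.natAbs) (Nat.size q.den) ≤ T := by
  obtain ⟨c, h1, h2⟩ := Rat.num_den_mk (mul_ne_zero hm hm') hq
  have hc : c ≠ 0 := by
    rintro rfl
    simp_all
  have hc' : 0 < c.natAbs := Int.natAbs_pos.2 hc
  have h1' : z.natAbs = c.natAbs * q.num.natAbs := by rw [h1, Int.natAbs_mul]
  have h2' : m * m' = c.natAbs * q.den := by
    have := congrArg Int.natAbs h2
    simpa [Int.natAbs_mul] using this
  refine max_le (Nat.size_le.2 ?_) (Nat.size_le.2 ?_)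
  · exact lt_of_le_of_lt (h1' ▸ Nat.le_mul_of_pos_left _ hc') hz
  · exact lt_of_le_of_lt (h2' ▸ Nat.le_mul_of_pos_left _ hc') hmT

/-- Bit-cost arithmetic on rational numbers: the height of `p / q` in lowest terms is the larger
one of the bit lengths of `p` and `q`. -/
def HeightFn.bit : HeightFn ℚ where
  ht a := max (Nat.size a.num.natAbs) (Nat.size a.den)
  ht_natCast_le m := by simp
  ht_add_le a b := by
    have ha := Nat.lt_size_self a.num.natAbs
    have hb := Nat.lt_size_self b.num.natAbs
    have ha' := Nat.lt_size_self a.den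
    have hb' := Nat.lt_size_self b.den
    set A := max (Nat.size a.num.natAbs) (Nat.size a.den) with hA
    set B := max (Nat.size b.num.natAbs) (Nat.size b.den) with hB
    have pA : ∀ {x m}, x < 2 ^ m → m ≤ A → x < 2 ^ A := fun hx hm =>
      hx.trans_le (Nat.pow_le_pow_right two_pos hm)
    have pB : ∀ {x m}, x < 2 ^ m → m ≤ B → x < 2 ^ B := fun hx hm =>
      hx.trans_le (Nat.pow_le_pow_right two_pos hm)
    refine size_le_of_eq_div (Rat.add_num_den a b)
      (Int.natCast_ne_zero.2 a.den_nz) (Int.natCast_ne_zero.2 b.den_nz) ?_ ?_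
    · have h1 : a.num.natAbs * b.den < 2 ^ (A + B) := by
        rw [pow_add]
        exact Nat.mul_lt_mul'' (pA ha (le_max_left _ _)) (pB hb' (le_max_right _ _))
      have h2 : a.den * b.num.natAbs < 2 ^ (A + B) := by
        rw [pow_add]
        exact Nat.mul_lt_mul'' (pA ha' (le_max_right _ _)) (pB hb (le_max_left _ _))
      have h3 := Int.natAbs_add_le (a.num * b.den) (a.den * b.num)
      simp only [Int.natAbs_mul, Int.natAbs_natCast] at h3
      rw [pow_succ]
      omega
    · have h1 : a.den * b.den < 2 ^ (A + B) := by
        rw [pow_add]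
        exact Nat.mul_lt_mul'' (pA ha' (le_max_right _ _)) (pB hb' (le_max_right _ _))
      rw [pow_succ]
      omega
  ht_mul_le a b := by
    have ha := Nat.lt_size_self a.num.natAbs
    have hb := Nat.lt_size_self b.num.natAbs
    have ha' := Nat.lt_size_self a.den
    have hb' := Nat.lt_size_self b.den
    set A := max (Nat.size a.num.natAbs) (Nat.size a.den) with hA
    set B := max (Nat.size b.num.natAbs) (Nat.size b.den) with hB
    have pA : ∀ {x m}, x < 2 ^ m → m ≤ A → x < 2 ^ A := fun hx hm =>
      hx.trans_le (Nat.pow_le_pow_right two_pos hm)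
    have pB : ∀ {x m}, x < 2 ^ m → m ≤ B → x < 2 ^ B := fun hx hm =>
      hx.trans_le (Nat.pow_le_pow_right two_pos hm)
    refine size_le_of_eq_div
      (by rw [← Rat.divInt_mul_divInt, Rat.num_divInt_den, Rat.num_divInt_den])
      (Int.natCast_ne_zero.2 a.den_nz) (Int.natCast_ne_zero.2 b.den_nz) ?_ ?_
    · have h1 : a.num.natAbs * b.num.natAbs < 2 ^ (A + B) := by
        rw [pow_add]
        exact Nat.mul_lt_mul'' (pA ha (le_max_left _ _)) (pB hb (le_max_left _ _))
      rw [Int.natAbs_mul, pow_succ]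
      omega
    · have h1 : a.den * b.den < 2 ^ (A + B) := by
        rw [pow_add]
        exact Nat.mul_lt_mul'' (pA ha' (le_max_right _ _)) (pB hb' (le_max_right _ _))
      rw [pow_succ]
      omega

/-! ## Data and programs -/

/-- Data: binary trees whose leaves are the empty tree `nil` or a number. -/
inductive Val (K : Type*) where
  | nil : Val K
  | num : K → Val K
  | cons : Val K → Val K → Val K

namespace Val

variable {K : Type*}

def fst : Val K → Val K
  | cons a _ => a
  | _ => nil

def snd : Val K → Val K
  | cons _ b => b
  | _ => nil

/-- Truth values: `nil` is false, every other tree is true. -/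
def ofBool : Bool → Val K
  | true => cons nil nil
  | false => nil

def isNum : Val K → Bool
  | num _ => true
  | _ => false

/-- Apply a binary operation on numbers to a pair of numbers. -/
def arith (f : K → K → Val K) : Val K → Val K
  | cons (num a) (num b) => f a b
  | _ => nil

/-- The height of a number; a tree that is not a number is handled through a pointer, for free. -/
def height [Field K] (h : HeightFn K) : Val K → ℕ
  | num a => h.ht a
  | _ => 0

/-- Natural numbers in unary. -/
def unary : ℕ → Val K
  | 0 => nil
  | m + 1 => cons nil (unary m)

/-- Lists as right-nested pairs. -/
def ofList : List (Val K) → Val K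
  | [] => nil
  | a :: l => cons a (ofList l)

end Val

/-- Elementary operations. -/
inductive Op where
  | id | nil | zero | one | fst | snd | isNum | add | sub | mul | div | le

namespace Op

variable {K : Type*} [Field K] [LinearOrder K]

/-- The effect of an elementary operation; the binary ones act on a pair (division by `0` gives
`0`, as in Mathlib, and operands that are not numbers give `nil`). -/
def eval : Op → Val K → Val K
  | .id, v => v
  | .nil, _ => .nil
  | .zero, _ => .num 0
  | .one, _ => .num 1
  | .fst, v => v.fst
  | .snd, v => v.snd
  | .isNum, v => .ofBool v.isNum
  | .add, v => v.arith fun a b => .num (a + b)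
  | .sub, v => v.arith fun a b => .num (a - b)
  | .mul, v => v.arith fun a b => .num (a * b)
  | .div, v => v.arith fun a b => .num (a / b)
  | .le, v => v.arith fun a b => .ofBool (decide (a ≤ b))

/-- Total height of the operands of an arithmetic operation. -/
def operandHeight (h : HeightFn K) : Op → Val K → ℕ
  | .add, v | .sub, v | .mul, v | .div, v | .le, v => v.fst.height h + v.snd.height h
  | _, _ => 0

/-- The time an elementary operation takes. -/
def cost (h : HeightFn K) (o : Op) (v : Val K) : ℕ :=
  1 + o.operandHeight h v + (o.eval v).height h

end Op

/-- Programs: a WHILE language over trees, in combinator form.  A program maps a tree to a tree;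
`pair f g` builds the pair of two results, `comp f g` runs `g` and then `f`, `ite c f g` branches
on whether `c` returns a tree other than `nil`, and `loop c f` replaces the current value `v` by
`f v` as long as `c v` is not `nil`. -/
inductive Prog where
  | op : Op → Prog
  | pair : Prog → Prog → Prog
  | comp : Prog → Prog → Prog
  | ite : Prog → Prog → Prog → Prog
  | loop : Prog → Prog → Prog

/-- `Runs h P v r t`: on input `v`, program `P` halts with output `r` after time exactly `t`. -/
inductive Runs {K : Type*} [Field K] [LinearOrder K] (h : HeightFn K) :
    Prog → Val K → Val K → ℕ → Prop where
  | op (o : Op) (v : Val K) : Runs h (.op o) v (o.eval v) (o.cost h v)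
  | pair {f g : Prog} {v a b : Val K} {s t : ℕ} :
      Runs h f v a s → Runs h g v b t → Runs h (.pair f g) v (.cons a b) (s + t + 1)
  | comp {f g : Prog} {v u r : Val K} {s t : ℕ} :
      Runs h g v u s → Runs h f u r t → Runs h (.comp f g) v r (s + t + 1)
  | iteTrue {c f g : Prog} {v b r : Val K} {s t : ℕ} :
      Runs h c v b s → b ≠ .nil → Runs h f v r t → Runs h (.ite c f g) v r (s + t + 1)
  | iteFalse {c f g : Prog} {v r : Val K} {s t : ℕ} :
      Runs h c v .nil s → Runs h g v r t → Runs h (.ite c f g) v r (s + t + 1)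
  | loopStop {c f : Prog} {v : Val K} {s : ℕ} :
      Runs h c v .nil s → Runs h (.loop c f) v v (s + 1)
  | loopStep {c f : Prog} {v b u r : Val K} {s t t' : ℕ} :
      Runs h c v b s → b ≠ .nil → Runs h f v u t → Runs h (.loop c f) u r t' →
      Runs h (.loop c f) v r (s + t + t' + 1)

/-- `P` halts on input `v` with output `r` within time `T`. -/
def RunsWithin {K : Type*} [Field K] [LinearOrder K] (h : HeightFn K)
    (P : Prog) (v r : Val K) (T : ℕ) : Prop :=
  ∃ t ≤ T, Runs h P v r t

/-! ## Distributions, evidence, decompositions -/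

/-- A partial assignment to the variables `X i`, `i : Fin n`, with values in `Fin d`. -/
abbrev PartialAssignment (n d : ℕ) := Fin n → Option (Fin d)

namespace PartialAssignment

variable {n d : ℕ}

/-- `e` assigns values to variables in `Y` only. -/
def IsEvidenceOn (Y : Finset (Fin n)) (e : PartialAssignment n d) : Prop :=
  ∀ i, (e i).isSome → i ∈ Y

/-- `y` assigns values to all variables in `Y`, and to no others. -/
def IsAssignmentOf (Y : Finset (Fin n)) (y : PartialAssignment n d) : Prop :=
  ∀ i, (y i).isSome ↔ i ∈ Y

/-- `y` agrees with `e` on all variables that `e` assigns. -/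
def Extends (y e : PartialAssignment n d) : Prop :=
  ∀ i v, e i = some v → y i = some v

/-- The list of the `n` entries, with `nil` for an unassigned variable and `v + 1` in unary for
the value `v`. -/
def encode {K : Type*} (e : PartialAssignment n d) : Val K :=
  .ofList (List.ofFn fun i => (e i).elim .nil fun v => .unary (v.val + 1))

end PartialAssignment

/-- A distribution `prob` of `n` random variables with values in `Fin d`, a subset `Y` of the
variables, a decomposition of `Y` into `k` disjoint components of `width` variables each, listed
in an order that aligns the components with each other, and a tree `desc` through which the
distribution is presented to programs (for example its parameters; it may be `nil`). -/
structure Model (K : Type*) [Field K] [LinearOrder K] (d : ℕ) where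
  n : ℕ
  prob : (Fin n → Fin d) → K
  prob_mem : prob ∈ stdSimplex K (Fin n → Fin d)
  Y : Finset (Fin n)
  k : ℕ
  width : ℕ
  width_pos : 0 < width
  component : Fin k → Fin width → Fin n
  component_injective : Function.Injective fun q : Fin k × Fin width => component q.1 q.2
  mem_Y_iff : ∀ i, i ∈ Y ↔ ∃ l j, component l j = i
  desc : Val K

namespace Model

variable {K : Type*} [Field K] [LinearOrder K] {d : ℕ}

open Classical in
/-- The probability of an event. -/
noncomputable def pr (M : Model K d) (A : Set (Fin M.n → Fin d)) : K :=
  ∑ x with x ∈ A, M.prob x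

/-- `Pr(e)`, the total probability of the full assignments that agree with `e`.  For an assignment
`y` of `Y` this is the sum of `Pr(y, z)` over all assignments `z` of the other variables. -/
noncomputable def marginal (M : Model K d) (e : PartialAssignment M.n d) : K :=
  M.pr {x | ∀ i v, e i = some v → x i = v}

/-- The decomposition of `Y` is exchangeable for the marginal distribution of `Y`:
`Pr(Y₁ = a₁, …, Yₖ = aₖ) = Pr(Y₁ = a_{π(1)}, …, Yₖ = a_{π(k)})` for all permutations `π`. -/
def MarginallyExchangeable (M : Model K d) : Prop :=
  ∀ (π : Equiv.Perm (Fin M.k)) (a : Fin M.k → Fin M.width → Fin d),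
    M.pr {x | ∀ l j, x (M.component l j) = a l j} =
      M.pr {x | ∀ l j, x (M.component l j) = a (π l) j}

/-- `y` is a most probable assignment of `Y` among those that agree with the evidence `e`. -/
def IsMPE (M : Model K d) (e y : PartialAssignment M.n d) : Prop :=
  y.IsAssignmentOf M.Y ∧ y.Extends e ∧
    ∀ y' : PartialAssignment M.n d, y'.IsAssignmentOf M.Y → y'.Extends e →
      M.marginal y' ≤ M.marginal y

/-- The list of the components, each the list of its variables, in unary. -/
def encodeDecomposition (M : Model K d) : Val K :=
  .ofList (List.ofFn fun l => .ofList (List.ofFn fun j => .unary (M.component l j).val))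

/-- The input of a program: the presentation of the distribution, the decomposition of `Y`, and a
partial assignment. -/
def input (M : Model K d) (e : PartialAssignment M.n d) : Val K :=
  .cons (.cons M.desc M.encodeDecomposition) e.encode

end Model

/-! By exchangeability, Pr(y) depends only on the multiset of the values a_1, ..., a_k of the
components. A component has fewer than (d+1)^W codes, so for fixed d and W there are only
polynomially many multisets. It suffices to list, for each multiset compatible with e, one
representative and the number of assignments extending e that have this multiset. The given program
evaluates Pr at the representatives; the largest value solves MPE, and the sum weighted by the
counts is Pr(e).

The evidence breaks the symmetry between components, so the counts are not multinomial coefficients;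
a dynamic program over the components computes them. The values in a component are read as a number
in base d+1, its `code`, and a multiset is stored as the `key` ∑_l B^(code of a_l) with B = n+1.
Since k < B, no carries occur and the key determines the multiset (`exists_perm_of_sum_pow_eq`,
`MarginallyExchangeable.marginal_eq`). For each component the program branches over the values that
the evidence admits, then merges entries with equal keys. Neither the admitted values nor the change
of the key depends on the representative, so merging preserves every weighted sum of a function of
the key, compared with the unmerged enumeration `full` (`tableSum_table`). For `full`, completeness
(`exists_mem_full`) and total probability (`sum_full`) are elementary; they transfer to the table in
`exists_mem_table` and `weightedSum_classTable`.

For the running time, `PolyTime` is a calculus of families of inputs and outputs. In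
`PolyTime.foldl` the step is bounded uniformly over all positions (`Split`) of all lists, so bounds
do not compound along a loop, but intermediate states need bounds known in advance. For the tables
these come from the keys: distinct keys of size at most k·B^((d+1)^W) bound the length
(`length_table_le`), and a total count of at most (d+1)^n bounds the bit sizes (`size_table_le`).
Bounds compound only over the at most W branchings inside one component (`Small.growth`). -/

/-! ## Polynomially bounded families -/

/-- A family of natural numbers that is bounded by a polynomial in the parameter `N`. -/
def PolyBdd {I : Type*} (N f : I → ℕ) : Prop :=
  ∃ p : Polynomial ℕ, ∀ i, f i ≤ p.eval (N i)

namespace PolyBdd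

variable {I J : Type*} {N f g : I → ℕ}

theorem mono (hg : PolyBdd N g) (hfg : ∀ i, f i ≤ g i) : PolyBdd N f :=
  let ⟨p, hp⟩ := hg
  ⟨p, fun i => (hfg i).trans (hp i)⟩

theorem const (c : ℕ) : PolyBdd N fun _ => c := ⟨Polynomial.C c, fun i => by simp⟩

theorem self : PolyBdd N N := ⟨Polynomial.X, fun i => by simp⟩

theorem add (hf : PolyBdd N f) (hg : PolyBdd N g) : PolyBdd N fun i => f i + g i :=
  let ⟨p, hp⟩ := hf
  let ⟨q, hq⟩ := hg
  ⟨p + q, fun i => by simpa using add_le_add (hp i) (hq i)⟩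

theorem mul (hf : PolyBdd N f) (hg : PolyBdd N g) : PolyBdd N fun i => f i * g i :=
  let ⟨p, hp⟩ := hf
  let ⟨q, hq⟩ := hg
  ⟨p * q, fun i => by simpa using Nat.mul_le_mul (hp i) (hq i)⟩

theorem pow (hf : PolyBdd N f) (c : ℕ) : PolyBdd N fun i => f i ^ c :=
  let ⟨p, hp⟩ := hf
  ⟨p ^ c, fun i => by simpa using Nat.pow_le_pow_left (hp i) c⟩

theorem reindex (hf : PolyBdd N f) (φ : J → I) :
    PolyBdd (fun j => N (φ j)) fun j => f (φ j) :=
  let ⟨p, hp⟩ := hf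
  ⟨p, fun j => hp (φ j)⟩

end PolyBdd

/-! ## Heights of trees -/

namespace Val

variable {K : Type*} [Field K] {h : HeightFn K}

@[simp] theorem height_nil : (nil : Val K).height h = 0 := rfl

@[simp] theorem height_num (a : K) : (num a).height h = h.ht a := rfl

@[simp] theorem height_cons (a b : Val K) : (cons a b).height h = 0 := rfl

@[simp] theorem height_ofBool (b : Bool) : (ofBool b : Val K).height h = 0 := by
  cases b <;> rfl

@[simp] theorem height_ofList (l : List (Val K)) : (ofList l).height h = 0 := by
  cases l <;> rfl

@[simp] theorem height_unary (m : ℕ) : (unary m : Val K).height h = 0 := by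
  cases m <;> rfl

end Val

/-! ## Running times of programs -/

section Runs

variable {K : Type*} [Field K] [LinearOrder K] {h : HeightFn K}

/-- Every elementary operation pays for the height of its result. Hence a time bound for the given
program also bounds the heights of the probabilities that it returns. -/
theorem Runs.height_le {P : Prog} {v r : Val K} {t : ℕ} (hr : Runs h P v r t) :
    r.height h ≤ v.height h + t := by
  induction hr with
  | op o v => simp only [Op.cost]; omega
  | pair => simp
  | comp _ _ h1 h2 => omega
  | iteTrue _ _ _ h1 h2 => omega
  | iteFalse _ _ h1 h2 => omega
  | loopStop => omega
  | loopStep _ _ _ _ h1 h2 h3 => omega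

namespace RunsWithin

variable {P Q f g c : Prog} {v u r a b : Val K} {S T T' : ℕ}

theorem mono (hr : RunsWithin h P v r T) (hT : T ≤ T') : RunsWithin h P v r T' :=
  let ⟨t, ht, hr⟩ := hr
  ⟨t, ht.trans hT, hr⟩

theorem height_le (hr : RunsWithin h P v r T) : r.height h ≤ v.height h + T := by
  obtain ⟨t, ht, hr⟩ := hr
  have := hr.height_le
  omega

theorem op (o : Op) (v : Val K) : RunsWithin h (.op o) v (o.eval v) (o.cost h v) :=
  ⟨_, le_rfl, .op o v⟩

theorem pair (hf : RunsWithin h f v a S) (hg : RunsWithin h g v b T) :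
    RunsWithin h (.pair f g) v (.cons a b) (S + T + 1) := by
  obtain ⟨s, hs, hf⟩ := hf
  obtain ⟨t, ht, hg⟩ := hg
  exact ⟨_, by omega, hf.pair hg⟩

theorem comp (hg : RunsWithin h g v u S) (hf : RunsWithin h f u r T) :
    RunsWithin h (.comp f g) v r (S + T + 1) := by
  obtain ⟨s, hs, hg⟩ := hg
  obtain ⟨t, ht, hf⟩ := hf
  exact ⟨_, by omega, hg.comp hf⟩

theorem iteTrue (hc : RunsWithin h c v b S) (hb : b ≠ .nil) (hf : RunsWithin h f v r T) :
    RunsWithin h (.ite c f g) v r (S + T + 1) := by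
  obtain ⟨s, hs, hc⟩ := hc
  obtain ⟨t, ht, hf⟩ := hf
  exact ⟨_, by omega, hc.iteTrue hb hf⟩

theorem iteFalse (hc : RunsWithin h c v .nil S) (hg : RunsWithin h g v r T) :
    RunsWithin h (.ite c f g) v r (S + T + 1) := by
  obtain ⟨s, hs, hc⟩ := hc
  obtain ⟨t, ht, hg⟩ := hg
  exact ⟨_, by omega, hc.iteFalse hg⟩

theorem loopStop (hc : RunsWithin h c v .nil S) : RunsWithin h (.loop c f) v v (S + 1) := by
  obtain ⟨s, hs, hc⟩ := hc
  exact ⟨_, by omega, hc.loopStop⟩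

theorem loopStep (hc : RunsWithin h c v b S) (hb : b ≠ .nil) (hf : RunsWithin h f v u T)
    (hl : RunsWithin h (.loop c f) u r T') :
    RunsWithin h (.loop c f) v r (S + T + T' + 1) := by
  obtain ⟨s, hs, hc⟩ := hc
  obtain ⟨t, ht, hf⟩ := hf
  obtain ⟨t', ht', hl⟩ := hl
  exact ⟨_, by omega, hc.loopStep hb hf hl⟩

theorem fst (a b : Val K) : RunsWithin h (.op .fst) (.cons a b) a (1 + a.height h) := by
  simpa [Op.cost, Op.eval, Op.operandHeight, Val.fst] using op (h := h) .fst (.cons a b)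

theorem snd (a b : Val K) : RunsWithin h (.op .snd) (.cons a b) b (1 + b.height h) := by
  simpa [Op.cost, Op.eval, Op.operandHeight, Val.snd] using op (h := h) .snd (.cons a b)

end RunsWithin

end Runs

/-! ## Families that are computable in polynomial time -/

/-- There is one program that computes `v i` from `u i` in time polynomial in `N i`, for all `i`.
Numbers that are given or computed as a whole have polynomially bounded height. -/
def PolyTime {K : Type*} [Field K] [LinearOrder K] (h : HeightFn K) {I : Type*} (N : I → ℕ)
    (u v : I → Val K) : Prop :=
  PolyBdd N (fun i => (u i).height h) ∧ PolyBdd N (fun i => (v i).height h) ∧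
    ∃ (P : Prog) (T : I → ℕ), PolyBdd N T ∧ ∀ i, RunsWithin h P (u i) (v i) (T i)

/-- A way to split a member of a family of lists at one of its elements. -/
structure Split {I : Type*} {α : I → Type*} (l : ∀ i, List (α i)) where
  idx : I
  pre : List (α idx)
  elt : α idx
  post : List (α idx)
  eq : l idx = pre ++ elt :: post

theorem Split.mem {I : Type*} {α : I → Type*} {l : ∀ i, List (α i)} (q : Split l) :
    q.elt ∈ l q.idx := by
  rw [q.eq]; simp

theorem Split.pre_subset {I : Type*} {α : I → Type*} {l : ∀ i, List (α i)} (q : Split l) :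
    q.pre ⊆ l q.idx := by
  rw [q.eq]; simp

theorem Split.prefix {I : Type*} {α : I → Type*} {l : ∀ i, List (α i)} (q : Split l) :
    q.pre <+: l q.idx := by
  rw [q.eq]; simp

namespace PolyTime

variable {K : Type*} [Field K] [LinearOrder K] {h : HeightFn K} {I J : Type*} {N : I → ℕ}
  {u v w a b c : I → Val K}

theorem height_left (H : PolyTime h N u v) : PolyBdd N fun i => (u i).height h := H.1

theorem height (H : PolyTime h N u v) : PolyBdd N fun i => (v i).height h := H.2.1

theorem reindex (H : PolyTime h N u v) (φ : J → I) :
    PolyTime h (fun j => N (φ j)) (fun j => u (φ j)) fun j => v (φ j) :=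
  let ⟨h1, h2, P, _, hT, hr⟩ := H
  ⟨h1.reindex φ, h2.reindex φ, P, _, hT.reindex φ, fun j => hr (φ j)⟩

theorem refl (hu : PolyBdd N fun i => (u i).height h) : PolyTime h N u u := by
  refine ⟨hu, hu, .op .id, _, (PolyBdd.const 1).add hu, fun i => ?_⟩
  simpa [Op.cost, Op.eval, Op.operandHeight] using RunsWithin.op (h := h) .id (u i)

theorem comp (H : PolyTime h N u v) (H' : PolyTime h N v w) : PolyTime h N u w := by
  obtain ⟨h1, h2, P, T, hT, hr⟩ := H
  obtain ⟨h1', h2', P', T', hT', hr'⟩ := H'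
  exact ⟨h1, h2', _, _, (hT.add hT').add (.const 1), fun i => (hr i).comp (hr' i)⟩

theorem pair (H : PolyTime h N u a) (H' : PolyTime h N u b) :
    PolyTime h N u fun i => .cons (a i) (b i) := by
  obtain ⟨h1, h2, P, T, hT, hr⟩ := H
  obtain ⟨h1', h2', P', T', hT', hr'⟩ := H'
  exact ⟨h1, .const 0, _, _, (hT.add hT').add (.const 1), fun i => (hr i).pair (hr' i)⟩

theorem fst (H : PolyTime h N u fun i => .cons (a i) (b i))
    (ha : PolyBdd N fun i => (a i).height h) : PolyTime h N u a :=
  H.comp ⟨.const 0, ha, .op .fst, _, (PolyBdd.const 1).add ha, fun _ => .fst _ _⟩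

theorem snd (H : PolyTime h N u fun i => .cons (a i) (b i))
    (hb : PolyBdd N fun i => (b i).height h) : PolyTime h N u b :=
  H.comp ⟨.const 0, hb, .op .snd, _, (PolyBdd.const 1).add hb, fun _ => .snd _ _⟩

theorem op_const (o : Op) (r : Val K) (ho : ∀ v, o.eval v = r)
    (hc : ∀ v, o.operandHeight h v = 0) (hu : PolyBdd N fun i => (u i).height h) :
    PolyTime h N u fun _ => r := by
  refine ⟨hu, .const _, .op o, fun _ => 1 + r.height h, .const _, fun i => ?_⟩
  simpa [Op.cost, ho, hc] using RunsWithin.op (h := h) o (u i)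

theorem nil (hu : PolyBdd N fun i => (u i).height h) : PolyTime h N u fun _ => .nil :=
  op_const .nil _ (fun _ => rfl) (fun _ => rfl) hu

theorem zero (hu : PolyBdd N fun i => (u i).height h) : PolyTime h N u fun _ => .num 0 :=
  op_const .zero _ (fun _ => rfl) (fun _ => rfl) hu

theorem one (hu : PolyBdd N fun i => (u i).height h) : PolyTime h N u fun _ => .num 1 :=
  op_const .one _ (fun _ => rfl) (fun _ => rfl) hu

theorem add {x y : I → K} (H : PolyTime h N u fun i => .num (x i))
    (H' : PolyTime h N u fun i => .num (y i)) : PolyTime h N u fun i => .num (x i + y i) := by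
  have hb := (H.height.add H'.height).add (.const 1)
  refine (H.pair H').comp ⟨.const 0, hb.mono fun i => h.ht_add_le _ _, .op .add, _,
    ((PolyBdd.const 1).add (H.height.add H'.height)).add hb, fun i => ?_⟩
  refine (RunsWithin.op (h := h) .add (.cons (.num (x i)) (.num (y i)))).mono ?_
  simpa [Op.cost, Op.eval, Op.operandHeight, Val.fst, Val.snd, Val.arith] using
    h.ht_add_le _ _

theorem mul {x y : I → K} (H : PolyTime h N u fun i => .num (x i))
    (H' : PolyTime h N u fun i => .num (y i)) : PolyTime h N u fun i => .num (x i * y i) := by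
  have hb := (H.height.add H'.height).add (.const 1)
  refine (H.pair H').comp ⟨.const 0, hb.mono fun i => h.ht_mul_le _ _, .op .mul, _,
    ((PolyBdd.const 1).add (H.height.add H'.height)).add hb, fun i => ?_⟩
  refine (RunsWithin.op (h := h) .mul (.cons (.num (x i)) (.num (y i)))).mono ?_
  simpa [Op.cost, Op.eval, Op.operandHeight, Val.fst, Val.snd, Val.arith] using
    h.ht_mul_le _ _

theorem pow {x : I → K} (H : PolyTime h N u fun i => .num (x i)) (m : ℕ) :
    PolyTime h N u fun i => .num (x i ^ m) := by
  induction m with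
  | zero => simpa using one H.height_left
  | succ m ih => simpa only [pow_succ] using ih.mul H

theorem le {x y : I → K} (H : PolyTime h N u fun i => .num (x i))
    (H' : PolyTime h N u fun i => .num (y i)) :
    PolyTime h N u fun i => .ofBool (decide (x i ≤ y i)) := by
  refine (H.pair H').comp ⟨.const 0, ?_, .op .le, _,
    (PolyBdd.const 1).add (H.height.add H'.height), fun i => ?_⟩
  · simpa using PolyBdd.const 0
  · simpa [Op.cost, Op.eval, Op.operandHeight, Val.fst, Val.snd, Val.arith] using RunsWithin.op (h := h) .le (.cons (.num (x i)) (.num (y i)))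

/-- Each branch has to be fast only on the indices that reach it. Its time is known only there, but
the bounding polynomial makes sense for all indices, and the sum of the two polynomials serves both
branches. -/
theorem ite (hc : PolyTime h N u c)
    (hf : PolyTime h (I := {i // c i ≠ .nil}) (fun i => N i) (fun i => u i) fun i => v i)
    (hg : PolyTime h (I := {i // c i = .nil}) (fun i => N i) (fun i => u i) fun i => v i) :
    PolyTime h N u v := by
  obtain ⟨h1, h2, C, T, hT, hr⟩ := hc
  obtain ⟨-, ⟨pv, hpv⟩, P, T', ⟨p, hp⟩, hr'⟩ := hf
  obtain ⟨-, ⟨qv, hqv⟩, Q, T'', ⟨q, hq⟩, hr''⟩ := hg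
  have hpq : PolyBdd N fun i => p.eval (N i) + q.eval (N i) :=
    ⟨p + q, fun i => by simp⟩
  refine ⟨h1, ⟨pv + qv, fun i => ?_⟩, .ite C P Q, _, (hT.add hpq).add (.const 1), fun i => ?_⟩
  · rw [Polynomial.eval_add]
    by_cases hi : c i = .nil
    · exact (hqv ⟨i, hi⟩).trans (Nat.le_add_left _ _)
    · exact (hpv ⟨i, hi⟩).trans (Nat.le_add_right _ _)
  · by_cases hi : c i = .nil
    · have := hr i
      rw [hi] at this
      exact this.iteFalse ((hr'' ⟨i, hi⟩).mono ((hq ⟨i, hi⟩).trans (Nat.le_add_left _ _)))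
    · exact (hr i).iteTrue hi ((hr' ⟨i, hi⟩).mono ((hp ⟨i, hi⟩).trans (Nat.le_add_right _ _)))

theorem ite_prop {q : I → Prop} [DecidablePred q]
    (hc : PolyTime h N u fun i => .ofBool (decide (q i)))
    (ha : PolyTime h N u a) (hb : PolyTime h N u b) :
    PolyTime h N u fun i => if q i then a i else b i := by
  refine hc.ite ?_ ?_
  · convert ha.reindex (Subtype.val (p := fun i => Val.ofBool (K := K) (decide (q i)) ≠ .nil))
      using 2 with i
    have := i.2
    by_cases hq : q i
    · simp [hq]
    · simp [hq, Val.ofBool] at this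
  · convert hb.reindex (Subtype.val (p := fun i => Val.ofBool (K := K) (decide (q i)) = .nil))
      using 2 with i
    have := i.2
    by_cases hq : q i
    · simp [hq, Val.ofBool] at this
    · simp [hq]

/-- Computations may ignore a part of their input. -/
theorem weaken (H : PolyTime h N u v) (φ : J → I) (x : J → Val K) :
    PolyTime h (fun j => N (φ j)) (fun j => .cons (x j) (u (φ j))) fun j => v (φ j) :=
  ((refl (.const 0)).snd (H.height_left.reindex φ)).comp (H.reindex φ)

theorem weaken₂ (H : PolyTime h N u v) (φ : J → I) (x y : J → Val K) :
    PolyTime h (fun j => N (φ j)) (fun j => .cons (x j) (.cons (y j) (u (φ j))))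
      fun j => v (φ j) :=
  (H.weaken φ y).weaken id x

theorem var₀ {x : I → Val K} (hx : PolyBdd N fun i => (x i).height h) :
    PolyTime h N (fun i => .cons (x i) (u i)) x :=
  (refl (.const 0)).fst hx

theorem var₁ {x y : I → Val K} (hy : PolyBdd N fun i => (y i).height h) :
    PolyTime h N (fun i => .cons (x i) (.cons (y i) (u i))) y :=
  (var₀ hy).weaken id x

/-- Iteration over a list. -/
theorem foldl {α σ : I → Type*} {l : ∀ i, List (α i)} {ea : ∀ i, α i → Val K}
    {es : ∀ i, σ i → Val K} {f : ∀ i, σ i → α i → σ i} {s₀ : ∀ i, σ i}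
    (hlen : PolyBdd N fun i => (l i).length) (hea : ∀ i a, (ea i a).height h = 0)
    (hl : PolyTime h N u fun i => .ofList ((l i).map (ea i)))
    (h₀ : PolyTime h N u fun i => es i (s₀ i))
    (hstep : PolyTime h (I := Split l) (fun q => N q.idx)
      (fun q => .cons (ea q.idx q.elt)
        (.cons (es q.idx (q.pre.foldl (f q.idx) (s₀ q.idx))) (u q.idx)))
      fun q => es q.idx (f q.idx (q.pre.foldl (f q.idx) (s₀ q.idx)) q.elt)) :
    PolyTime h N u fun i => es i ((l i).foldl (f i) (s₀ i)) := by
  obtain ⟨pu, hpu⟩ := hl.height_left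
  obtain ⟨p₀, hp₀⟩ := h₀.height
  -- One polynomial `p` bounds the step at every position of every list, so the times of the
  -- iterations merely add up.
  obtain ⟨-, ⟨ps, hps⟩, P, T, ⟨p, hp⟩, hr⟩ := hstep
  -- The final state is the initial one or the result of a step at the last position.
  have hes : PolyBdd N fun i => (es i ((l i).foldl (f i) (s₀ i))).height h := by
    refine ⟨p₀ + ps, fun i => ?_⟩
    rw [Polynomial.eval_add]
    rcases List.eq_nil_or_concat (l i) with hi | ⟨pre, a, hi⟩
    · simp only [hi]
      exact (hp₀ i).trans (Nat.le_add_right _ _)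
    · rw [List.concat_eq_append] at hi
      have := hps ⟨i, pre, a, [], hi⟩
      simp only [hi, List.foldl_append]
      exact this.trans (Nat.le_add_left _ _)
  refine (hl.pair (h₀.pair (refl hl.height_left))).comp (v := fun i =>
    .cons (Val.ofList ((l i).map (ea i))) (.cons (es i (s₀ i)) (u i))) ?_
  refine PolyTime.comp (v := fun i =>
    .cons .nil (.cons (es i ((l i).foldl (f i) (s₀ i))) (u i))) ?_
    (((refl (.const 0)).snd (.const 0)).fst hes)
  -- The loop state is the remaining list, the accumulator and the unchanged input `u i`.
  let body : Prog := .pair (.comp (.op .snd) (.op .fst))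
    (.pair (.comp P (.pair (.comp (.op .fst) (.op .fst)) (.op .snd)))
      (.comp (.op .snd) (.op .snd)))
  -- `pu` pays for copying `u i` in case it is a number, and `20` for the fixed number of
  -- projections and pairings.
  let C : I → ℕ := fun i => p.eval (N i) + pu.eval (N i) + 20
  refine ⟨.const 0, .const 0, .loop (.op .fst) body, fun i => (l i).length * C i + 2, ?_, ?_⟩
  · exact (hlen.mul ⟨p + pu + 20, fun i => by simp [C]⟩).add (.const 2)
  intro i
  -- The summand `2` pays for the last test, which ends the loop.
  have key : ∀ post pre, l i = pre ++ post →
      RunsWithin h (.loop (.op .fst) body)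
        (.cons (.ofList (post.map (ea i))) (.cons (es i (pre.foldl (f i) (s₀ i))) (u i)))
        (.cons .nil (.cons (es i ((l i).foldl (f i) (s₀ i))) (u i)))
        (post.length * C i + 2) := by
    intro post
    induction post with
    | nil =>
      intro pre hpre
      rw [List.append_nil] at hpre
      rw [← hpre]
      exact (RunsWithin.loopStop (RunsWithin.fst (h := h) _ _)).mono (by simp)
    | cons a post ih =>
      intro pre hpre
      have h1 := hr ⟨i, pre, a, post, hpre⟩
      have h2 := hp ⟨i, pre, a, post, hpre⟩
      have h3 := ih (pre ++ [a]) (by simp [hpre])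
      rw [List.foldl_append] at h3
      have h4 := RunsWithin.fst (h := h) (Val.ofList ((a :: post).map (ea i)))
        (.cons (es i (pre.foldl (f i) (s₀ i))) (u i))
      have h5 := RunsWithin.snd (h := h) (Val.ofList ((a :: post).map (ea i)))
        (.cons (es i (pre.foldl (f i) (s₀ i))) (u i))
      have h6 := RunsWithin.fst (h := h) (ea i a) (Val.ofList (post.map (ea i)))
      have h7 := RunsWithin.snd (h := h) (ea i a) (Val.ofList (post.map (ea i)))
      have h8 := RunsWithin.snd (h := h) (es i (pre.foldl (f i) (s₀ i))) (u i)
      refine ((RunsWithin.loopStep h4 (by simp [Val.ofList])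
        ((h4.comp h7).pair ((((h4.comp h6).pair h5).comp h1).pair (h5.comp h8))) h3)).mono ?_
      have h9 := hpu i
      simp only [Val.height_ofList, Val.height_cons, hea, List.length_cons, C, add_mul,
        one_mul] at h2 h9 ⊢
      omega
  simpa using key (l i) [] rfl

end PolyTime

/-! ## Operations on lists and on natural numbers -/

namespace Val

variable {K : Type*}

theorem ofList_replicate_nil (m : ℕ) : (ofList (List.replicate m nil) : Val K) = unary m := by
  induction m with
  | zero => rfl
  | succ m ih => rw [List.replicate_succ, ofList, ih, unary]

theorem snd_ofList (l : List (Val K)) : (ofList l).snd = ofList l.tail := by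
  cases l <;> rfl

theorem fst_ofList (l : List (Val K)) : (ofList l).fst = l.head?.getD nil := by
  cases l <;> rfl

end Val

section NatSize

theorem Nat.size_mul_le (a b : ℕ) : Nat.size (a * b) ≤ Nat.size a + Nat.size b := by
  rw [Nat.size_le, pow_add]
  exact Nat.mul_lt_mul'' (Nat.lt_size_self a) (Nat.lt_size_self b)

theorem Nat.size_add_le (a b : ℕ) : Nat.size (a + b) ≤ Nat.size a + Nat.size b + 1 := by
  have ha := (Nat.lt_size_self a).trans_le
    (Nat.pow_le_pow_right two_pos (Nat.le_add_right (Nat.size a) (Nat.size b)))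
  have hb := (Nat.lt_size_self b).trans_le
    (Nat.pow_le_pow_right two_pos (Nat.le_add_left (Nat.size b) (Nat.size a)))
  rw [Nat.size_le, pow_succ]
  omega

theorem Nat.size_pow_le (a m : ℕ) : Nat.size (a ^ m) ≤ m * Nat.size a + 1 := by
  induction m with
  | zero => simp
  | succ m ih =>
    rw [pow_succ]
    have := Nat.size_mul_le (a ^ m) a
    rw [add_mul]
    omega

theorem Nat.size_le_self (m : ℕ) : Nat.size m ≤ m :=
  Nat.size_le.2 Nat.lt_two_pow_self

end NatSize

theorem List.foldl_tail_replicate {α : Type*} (m : ℕ) (l : List α) :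
    (List.replicate m ()).foldl (fun s _ => s.tail) l = l.drop m := by
  induction m generalizing l with
  | zero => rfl
  | succ m ih => rw [List.replicate_succ, List.foldl_cons, ih, List.drop_tail]

theorem List.foldl_flip_cons {α : Type*} (l l' : List α) :
    l.foldl (fun acc x => x :: acc) l' = l.reverse ++ l' := by
  induction l generalizing l' with
  | nil => rfl
  | cons a l ih => rw [List.foldl_cons, ih]; simp

/-- The default `a` is never used, because `hm` keeps the second list nonempty while entries are
moved. -/
theorem List.foldl_zipper {α : Type*} (a : α) (m : ℕ) (r l : List α) (hm : m ≤ l.length) :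
    (List.replicate m ()).foldl (fun s _ => (s.2.head?.getD a :: s.1, s.2.tail)) (r, l) =
      ((l.take m).reverse ++ r, l.drop m) := by
  induction m generalizing r l with
  | zero => rfl
  | succ m ih =>
    cases l with
    | nil => simp at hm
    | cons b l =>
      rw [List.replicate_succ, List.foldl_cons, ih _ _ (by simpa using hm)]
      simp

theorem PolyBdd.ht_natCast {K : Type*} [Field K] {h : HeightFn K} {I : Type*} {N m : I → ℕ}
    (hm : PolyBdd N fun i => Nat.size (m i)) : PolyBdd N fun i => h.ht (m i : K) :=
  (hm.add (.const 1)).mono fun _ => h.ht_natCast_le _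

namespace PolyTime

variable {K : Type*} [Field K] [LinearOrder K] {h : HeightFn K} {I J : Type*} {N : I → ℕ}
  {u v w a b c : I → Val K}

theorem op_fst (H : PolyTime h N u v) (hv : PolyBdd N fun i => (v i).fst.height h) :
    PolyTime h N u fun i => (v i).fst :=
  H.comp ⟨H.height, hv, .op .fst, _, (PolyBdd.const 1).add hv, fun i => by
    simpa [Op.cost, Op.eval, Op.operandHeight] using RunsWithin.op (h := h) .fst (v i)⟩

theorem op_snd (H : PolyTime h N u v) (hv : PolyBdd N fun i => (v i).snd.height h) :
    PolyTime h N u fun i => (v i).snd :=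
  H.comp ⟨H.height, hv, .op .snd, _, (PolyBdd.const 1).add hv, fun i => by
    simpa [Op.cost, Op.eval, Op.operandHeight] using RunsWithin.op (h := h) .snd (v i)⟩

theorem unary (hu : PolyBdd N fun i => (u i).height h) (m : ℕ) :
    PolyTime h N u fun _ => .unary m := by
  induction m with
  | zero => exact nil hu
  | succ m ih => exact (nil hu).pair ih

theorem unary_replicate {m : I → ℕ} (H : PolyTime h N u fun i => .unary (m i)) :
    PolyTime h N u fun i => .ofList ((List.replicate (m i) ()).map fun _ => .nil) := by
  simpa [Val.ofList_replicate_nil] using H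

/-- Only `≤` is elementary, so equality takes two comparisons; the cast into an ordered field
reflects the order. -/
theorem eq_natCast [IsStrictOrderedRing K] {x y : I → ℕ}
    (H : PolyTime h N u fun i => .num (x i : K)) (H' : PolyTime h N u fun i => .num (y i : K))
    (ha : PolyTime h N u a) (hb : PolyTime h N u b) :
    PolyTime h N u fun i => if x i = y i then a i else b i := by
  have := ite_prop (H.le H') (ite_prop (H'.le H) ha hb) hb
  refine cast (congrArg _ (funext fun i => ?_)) this
  simp only [Nat.cast_le]
  split_ifs <;> first | rfl | omega

/-- Reading an entry of a list. -/
theorem getElem {l : I → List (Val K)} {j : I → ℕ} (hl : PolyTime h N u fun i => .ofList (l i))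
    (hj : PolyTime h N u fun i => .unary (j i)) (hjN : PolyBdd N j)
    (hh : ∀ i, ∀ x ∈ l i, x.height h = 0) (hjl : ∀ i, j i < (l i).length) :
    PolyTime h N u fun i => (l i)[j i]'(hjl i) := by
  have hdrop : PolyTime h N u fun i => .ofList ((l i).drop (j i)) := by
    -- A number in unary is a list of `nil`s, hence a loop counter: the loop takes `j i` tails.
    have := foldl (α := fun _ => Unit) (σ := fun _ => List (Val K)) (ea := fun _ _ => .nil)
      (es := fun _ => .ofList) (f := fun _ s _ => s.tail) (l := fun i => .replicate (j i) ())
      (s₀ := l) (by simpa using hjN) (by simp) hj.unary_replicate hl (by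
        simp only [← Val.snd_ofList]
        exact (var₁ (by simpa using PolyBdd.const 0)).op_snd
          (by simpa [Val.snd_ofList] using PolyBdd.const 0))
    simpa only [List.foldl_tail_replicate] using this
  have key : ∀ i, (Val.ofList ((l i).drop (j i))).fst = (l i)[j i]'(hjl i) := fun i => by
    rw [List.drop_eq_getElem_cons (hjl i)]
    rfl
  simp only [← key]
  refine hdrop.op_fst ?_
  simp only [key]
  exact (PolyBdd.const 0).mono fun i => (hh i _ (List.getElem_mem _)).le

/-- Reversing a list. -/
theorem reverse_append {l l' : I → List (Val K)} (hl : PolyTime h N u fun i => .ofList (l i))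
    (hl' : PolyTime h N u fun i => .ofList (l' i)) (hlen : PolyBdd N fun i => (l i).length)
    (hh : ∀ i, ∀ x ∈ l i, x.height h = 0) :
    PolyTime h N u fun i => .ofList ((l i).reverse ++ l' i) := by
  -- `foldl` needs height zero for all elements of the element type, whereas `hh` covers only the
  -- members of the list; hence the subtype.
  have := foldl (α := fun i => {x // x ∈ l i}) (σ := fun _ => List (Val K))
    (ea := fun _ x => x.1)
    (es := fun _ => .ofList) (f := fun _ s x => x.1 :: s) (l := fun i => (l i).attach)
    (s₀ := l') (by simpa using hlen) (fun i x => hh i _ x.2)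
    (by simpa using hl) hl' (by
      exact (var₀ (by simpa [hh _ _ (Subtype.property _)] using PolyBdd.const 0)).pair
        (var₁ (by simpa using PolyBdd.const 0)))
  have e : ∀ i, (l i).attach.foldl (fun s x => x.1 :: s) (l' i) = (l i).reverse ++ l' i :=
    fun i => by
      rw [← List.foldl_flip_cons, ← List.foldl_map (f := Subtype.val)
        (g := fun acc x => x :: acc), List.attach_map_subtype_val]
  simpa only [e] using this

/-- Writing an entry of a list. -/
theorem set {l : I → List (Val K)} {j : I → ℕ} (hl : PolyTime h N u fun i => .ofList (l i))
    (hj : PolyTime h N u fun i => .unary (j i)) (ha : PolyTime h N u a) (hjN : PolyBdd N j)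
    (hh : ∀ i, ∀ x ∈ l i, x.height h = 0) (hjl : ∀ i, j i < (l i).length) :
    PolyTime h N u fun i => .ofList ((l i).set (j i) (a i)) := by
  -- A zipper: the first `j i` entries are stacked in reverse order, the next one is exchanged, and
  -- the stack is put back.
  have hzip := foldl (α := fun _ => Unit) (σ := fun i => List (Val K) × List (Val K))
    (ea := fun _ _ => .nil) (es := fun _ s => .cons (.ofList s.1) (.ofList s.2))
    (f := fun _ s _ => (s.2.head?.getD .nil :: s.1, s.2.tail))
    (l := fun i => .replicate (j i) ()) (s₀ := fun i => ([], l i)) (by simpa using hjN)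
    (by simp) hj.unary_replicate ((nil hl.height_left).pair hl) (by
      have hs := (var₁ (h := h) (N := fun q : Split (fun i => List.replicate (j i) ()) => N q.idx)
        (x := fun _ => .nil) (y := fun q => Val.cons
          (.ofList (q.pre.foldl (fun (s : List (Val K) × List (Val K)) _ =>
            (s.2.head?.getD .nil :: s.1, s.2.tail)) ([], l q.idx)).1)
          (.ofList (q.pre.foldl (fun (s : List (Val K) × List (Val K)) _ =>
            (s.2.head?.getD .nil :: s.1, s.2.tail)) ([], l q.idx)).2))
        (u := fun q => u q.idx) (.const 0))
      have h1 := hs.fst (by simpa using PolyBdd.const 0)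
      have h2 := hs.snd (by simpa using PolyBdd.const 0)
      have h3 := ((h2.op_fst ?_).pair h1).pair (h2.op_snd ?_)
      · simpa only [Val.snd_ofList, Val.ofList, Val.fst_ofList] using h3
      · refine (PolyBdd.const 0).mono fun q => ?_
        -- A list of units is determined by its length, so the state is the zipper at depth `k`, and
        -- the head of its second list, if any, is an entry of the original list.
        have hq : ∀ k, (List.replicate k ()) = q.pre → k ≤ (l q.idx).length →
            ((Val.ofList (q.pre.foldl (fun (s : List (Val K) × List (Val K)) _ =>
            (s.2.head?.getD .nil :: s.1, s.2.tail)) ([], l q.idx)).2).fst).height h ≤ 0 := by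
          intro k hk hkl
          rw [← hk, List.foldl_zipper _ _ _ _ hkl, Val.fst_ofList]
          rcases hd : ((l q.idx).drop k) with _ | ⟨x, t⟩
          · simp
          · exact (hh q.idx x (List.drop_subset k _ (hd ▸ List.mem_cons_self))).le
        refine hq q.pre.length ?_ ?_
        · exact (List.eq_replicate_iff.2 ⟨rfl, fun _ _ => rfl⟩).symm
        · have := congrArg List.length q.eq
          have := hjl q.idx
          simp at *
          omega
      · simpa [Val.snd_ofList] using PolyBdd.const 0)
  simp only [List.foldl_zipper _ _ _ _ (hjl _).le, List.append_nil] at hzip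
  have h1 := hzip.fst (by simpa using PolyBdd.const 0)
  have h2 := hzip.snd (by simpa using PolyBdd.const 0)
  have h3 := h2.op_snd (by simpa [Val.snd_ofList] using PolyBdd.const 0)
  have h4 := reverse_append (l' := fun i => a i :: (l i).drop (j i + 1)) h1 (by
    simpa [Val.snd_ofList, Val.ofList] using ha.pair h3) (hjN.mono fun i => by simp)
    (fun i x hx => hh i x (List.take_subset _ _ (List.mem_reverse.1 hx)))
  refine cast (congrArg _ (funext fun i => ?_)) h4
  rw [List.set_eq_take_append_cons_drop, if_pos (hjl i), List.reverse_reverse]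

/-- The length of a list, as a number. -/
theorem natCast_length {α : I → Type*} {l : ∀ i, List (α i)} {ea : ∀ i, α i → Val K}
    (hl : PolyTime h N u fun i => .ofList ((l i).map (ea i)))
    (hlen : PolyBdd N fun i => (l i).length) (hea : ∀ i a, (ea i a).height h = 0) :
    PolyTime h N u fun i => .num ((l i).length : K) := by
  have e : ∀ {i : I} (l : List (α i)), l.foldl (fun s _ => s + 1) 0 = l.length := by
    intro i l
    induction l using List.reverseRecOn with
    | nil => rfl
    | append_singleton l a ih => rw [List.foldl_append, ih]; simp
  have := foldl (σ := fun _ => ℕ) (ea := ea) (es := fun _ s => .num (s : K))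
    (f := fun _ s _ => s + 1) (s₀ := fun _ => 0) hlen hea hl
    (by simpa using zero hl.height_left) (by
      simp only [e, Nat.cast_succ]
      refine add (var₁ ?_) (one (.const 0))
      refine PolyBdd.ht_natCast ((hlen.reindex Split.idx).mono fun q => ?_)
      exact (Nat.size_le_self _).trans q.prefix.length_le)
  simpa only [e] using this

/-- Multiplication by a power with exponent in unary. -/
theorem mul_pow_natCast {x y m : I → ℕ} (hx : PolyTime h N u fun i => .num (x i : K))
    (hy : PolyTime h N u fun i => .num (y i : K)) (hm : PolyTime h N u fun i => .unary (m i))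
    (hxN : PolyBdd N fun i => Nat.size (x i)) (hyN : PolyBdd N fun i => Nat.size (y i))
    (hmN : PolyBdd N m) : PolyTime h N u fun i => .num ((x i * y i ^ m i : ℕ) : K) := by
  have e : ∀ (l : List Unit) (x y : ℕ), l.foldl (fun s _ => s * y) x = x * y ^ l.length := by
    intro l x y
    induction l using List.reverseRecOn with
    | nil => simp
    | append_singleton l a ih => rw [List.foldl_append, ih]; simp [pow_succ, mul_assoc]
  have := foldl (α := fun _ => Unit) (σ := fun _ => ℕ) (ea := fun _ _ => .nil)
    (es := fun _ s => .num (s : K)) (f := fun i s _ => s * y i)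
    (l := fun i => .replicate (m i) ()) (s₀ := x) (by simpa using hmN) (by simp)
    hm.unary_replicate hx (by
      simp only [e, Nat.cast_mul _ (y _)]
      refine mul (var₁ ?_) (hy.weaken₂ Split.idx _ _)
      -- All partial products are `x * y ^ m'` with `m' ≤ m`, which bounds their bit sizes directly.
      refine PolyBdd.ht_natCast (((hxN.add ((hmN.mul hyN).add (.const 1))).reindex
        Split.idx).mono fun q => (Nat.size_mul_le _ _).trans ?_)
      refine Nat.add_le_add_left ((Nat.size_pow_le _ _).trans ?_) _
      have := q.prefix.length_le
      rw [List.length_replicate] at this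
      gcongr)
  simpa only [e, List.length_replicate] using this

end PolyTime

/-! ## Operations on partial assignments -/

namespace PartialAssignment

variable {n d : ℕ} {K : Type*}

/-- The tree for one entry of a partial assignment. -/
def encodeEntry (o : Option (Fin d)) : Val K := o.elim .nil fun v => .unary (v.val + 1)

@[simp] theorem height_encodeEntry [Field K] {h : HeightFn K} (o : Option (Fin d)) :
    (encodeEntry o : Val K).height h = 0 := by
  cases o <;> simp [encodeEntry]

theorem encode_eq (e : PartialAssignment n d) :
    (e.encode : Val K) = .ofList (List.ofFn fun i => encodeEntry (e i)) := rfl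

theorem encode_update (e : PartialAssignment n d) (j : Fin n) (o : Option (Fin d)) :
    (encode (Function.update e j o) : Val K) =
      .ofList ((List.ofFn fun i => encodeEntry (e i)).set j (encodeEntry o)) := by
  rw [encode_eq]
  congr 1
  refine List.ext_getElem (by simp) fun m h1 h2 => ?_
  rw [List.getElem_set]
  simp only [List.getElem_ofFn, Function.update_apply, Fin.ext_iff]
  split_ifs <;> first | rfl | omega

@[simp] theorem height_encode [Field K] {h : HeightFn K} (e : PartialAssignment n d) :
    (e.encode : Val K).height h = 0 := Val.height_ofList _

end PartialAssignment

namespace PolyTime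

open PartialAssignment

variable {K : Type*} [Field K] [LinearOrder K] {h : HeightFn K} {I : Type*} {N : I → ℕ}
  {u : I → Val K} {d : ℕ} {e : ∀ i, PartialAssignment (N i) d} {j : ∀ i, Fin (N i)}

theorem encodeEntry (he : PolyTime h N u fun i => (e i).encode)
    (hj : PolyTime h N u fun i => .unary (j i).val) :
    PolyTime h N u fun i => encodeEntry (e i (j i)) := by
  have := getElem he hj (PolyBdd.self.mono fun i => (j i).2.le) (by
    intro _ x hx
    obtain ⟨m, rfl⟩ := (List.mem_ofFn' _ _).1 hx
    exact height_encodeEntry _) (by simp)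
  simp only [List.getElem_ofFn] at this
  exact this

theorem encode_update {o : I → Option (Fin d)} (he : PolyTime h N u fun i => (e i).encode)
    (hj : PolyTime h N u fun i => .unary (j i).val)
    (ho : PolyTime h N u fun i => PartialAssignment.encodeEntry (o i)) :
    PolyTime h N u fun i => encode (Function.update (e i) (j i) (o i)) := by
  simp only [PartialAssignment.encode_update]
  refine set he hj ho (PolyBdd.self.mono fun i => (j i).2.le) ?_ (by simp)
  intro _ x hx
  obtain ⟨m, rfl⟩ := (List.mem_ofFn' _ _).1 hx
  exact height_encodeEntry _

end PolyTime

/-! ## The dynamic program -/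

/-- An entry of the table of the dynamic program: a partial assignment that represents a class of
exchangeable ones, the number `cnt` of assignments in its class, the `key` of the class, and a
number `t` that encodes the values in the component that is being assigned. -/
structure TableEntry (n d : ℕ) where
  key : ℕ
  t : ℕ
  cnt : ℕ
  asg : PartialAssignment n d

namespace TableEntry

variable {n d : ℕ}

/-- Assign a value to the variable `j`. -/
def assign (B : ℕ) (j : Fin n) (x : TableEntry n d) (v : Fin d) : TableEntry n d where
  key := x.key
  t := x.t ^ (d + 1) * B ^ (v.val + 1)
  cnt := x.cnt
  asg := Function.update x.asg j (some v)

/-- The values that a variable with given evidence may take. -/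
def options (o : Option (Fin d)) : List (Fin d) := o.elim (List.finRange d) fun v => [v]

/-- Assign to the variable `j` all values that the evidence `e` admits. -/
def branch (B : ℕ) (e : PartialAssignment n d) (X : List (TableEntry n d)) (j : Fin n) :
    List (TableEntry n d) :=
  X.foldl (fun acc x => (options (e j)).foldl (fun acc v => x.assign B j v :: acc) acc) []

/-- All variables of the current component have been assigned. -/
def close (x : TableEntry n d) : TableEntry n d where
  key := x.key + x.t
  t := 1
  cnt := x.cnt
  asg := x.asg

/-- Merge `s` with the current entry if the keys are equal, and retain it otherwise. -/
def absorb (c : TableEntry n d × List (TableEntry n d)) (s : TableEntry n d) :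
    TableEntry n d × List (TableEntry n d) :=
  if c.1.key = s.key then ({ c.1 with cnt := c.1.cnt + s.cnt }, c.2) else (c.1, s :: c.2)

/-- Insert an entry whose current component is complete into a table. -/
def insert (S : List (TableEntry n d)) (x : TableEntry n d) : List (TableEntry n d) :=
  (S.foldl absorb (x.close, [])).1 :: (S.foldl absorb (x.close, [])).2

/-- Complete the current component and merge entries with the same key. -/
def merge (X : List (TableEntry n d)) : List (TableEntry n d) := X.foldl insert []

/-- Process a component. -/
def step (B : ℕ) (e : PartialAssignment n d) (S : List (TableEntry n d)) (c : List (Fin n)) :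
    List (TableEntry n d) :=
  merge (c.foldl (branch B e) S)

/-- The table after processing a list of components. -/
def table (B : ℕ) (e : PartialAssignment n d) (cs : List (List (Fin n))) :
    List (TableEntry n d) :=
  cs.foldl (step B e) [⟨0, 1, 1, e⟩]

/-- Bit size of the numbers in an entry. -/
def size (x : TableEntry n d) : ℕ := Nat.size x.key + Nat.size x.t + Nat.size x.cnt

/-- The sum of the multiplicities in a table. -/
def total (S : List (TableEntry n d)) : ℕ := (S.map cnt).sum

/-! ### Branching and merging: sums, lengths and bit sizes. -/

theorem foldl_cons_eq {α β : Type*} (f : α → β) (l : List α) (acc : List β) :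
    l.foldl (fun acc v => f v :: acc) acc = (l.map f).reverse ++ acc := by
  induction l generalizing acc with
  | nil => rfl
  | cons a l ih => rw [List.foldl_cons, ih]; simp

theorem branch_eq (B : ℕ) (e : PartialAssignment n d) (X : List (TableEntry n d)) (j : Fin n) :
    branch B e X j = (X.flatMap fun x => (options (e j)).map (x.assign B j)).reverse := by
  unfold branch
  simp only [foldl_cons_eq]
  induction X using List.reverseRecOn with
  | nil => rfl
  | append_singleton X x ih => rw [List.foldl_append, ih]; simp

theorem mem_branch {B : ℕ} {e : PartialAssignment n d} {X : List (TableEntry n d)} {j : Fin n}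
    {y : TableEntry n d} :
    y ∈ branch B e X j ↔ ∃ x ∈ X, ∃ v ∈ options (e j), x.assign B j v = y := by
  simp [branch_eq]

theorem length_options_le (o : Option (Fin d)) : (options o).length ≤ d + 1 := by
  cases o <;> simp [options]

theorem sum_branch {M : Type*} [AddCommMonoid M] (g : TableEntry n d → M) (B : ℕ)
    (e : PartialAssignment n d) (X : List (TableEntry n d)) (j : Fin n) :
    ((branch B e X j).map g).sum =
      (X.map fun x => ((options (e j)).map fun v => g (x.assign B j v)).sum).sum := by
  rw [branch_eq, List.map_reverse, List.sum_reverse]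
  induction X with
  | nil => rfl
  | cons x X ih => rw [List.flatMap_cons, List.map_append, List.sum_append, ih]; simp; rfl

theorem length_branch_le (B : ℕ) (e : PartialAssignment n d) (X : List (TableEntry n d))
    (j : Fin n) : (branch B e X j).length ≤ (d + 1) * X.length := by
  rw [branch_eq]
  induction X with
  | nil => simp
  | cons x X ih =>
    have := length_options_le (e j)
    simp only [List.length_reverse, List.flatMap_cons, List.length_append, List.length_map,
      List.length_cons, mul_add] at ih ⊢
    omega

theorem total_branch_le (B : ℕ) (e : PartialAssignment n d) (X : List (TableEntry n d))
    (j : Fin n) : total (branch B e X j) ≤ (d + 1) * total X := by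
  rw [total, sum_branch, total]
  induction X with
  | nil => simp
  | cons x X ih =>
    have := Nat.mul_le_mul_right x.cnt (length_options_le (e j))
    simp [assign, mul_add] at ih this ⊢
    omega

/-- Absorbing an entry leaves the key of the current one unchanged, so all entries are compared with
the same key. -/
theorem foldl_absorb (S : List (TableEntry n d)) (c : TableEntry n d)
    (D : List (TableEntry n d)) :
    S.foldl absorb (c, D) = ({ c with cnt := c.cnt + total (S.filter (c.key = ·.key)) },
      (S.filter (c.key ≠ ·.key)).reverse ++ D) := by
  induction S generalizing c D with
  | nil => rfl
  | cons s S ih =>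
    rw [List.foldl_cons, absorb]
    split_ifs with hs
    · rw [ih]
      replace hs : c.key = s.key := hs
      simp [hs, total, add_assoc]
    · rw [ih]
      simp [hs, total]

theorem insert_eq (S : List (TableEntry n d)) (x : TableEntry n d) :
    insert S x = { x.close with cnt := x.cnt + total (S.filter (x.key + x.t = ·.key)) } ::
      (S.filter (x.key + x.t ≠ ·.key)).reverse := by
  simp [insert, foldl_absorb, close]

theorem total_filter_le (S : List (TableEntry n d)) (p : TableEntry n d → Bool) :
    total (S.filter p) ≤ total S :=
  (List.filter_sublist.map cnt).sum_le_sum fun _ _ => Nat.zero_le _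

/-- Merging does not change weighted sums of functions of the key. -/
theorem sum_insert {M : Type*} [AddCommMonoid M] (g : ℕ → M) (S : List (TableEntry n d))
    (x : TableEntry n d) :
    ((insert S x).map fun y => y.cnt • g y.key).sum =
      x.cnt • g (x.key + x.t) + (S.map fun y => y.cnt • g y.key).sum := by
  rw [insert_eq, List.map_cons, List.sum_cons, List.map_reverse, List.sum_reverse]
  simp only [close, add_smul, add_assoc]
  congr 1
  induction S with
  | nil => simp [total]
  | cons s S ih =>
    rw [List.map_cons, List.sum_cons, ← ih]
    by_cases hs : x.key + x.t = s.key
    · simp [hs, total, add_smul, add_assoc]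
    · simp [hs, add_left_comm]

/-- The monoid is arbitrary so that total counts, indicators of keys and sums of probabilities are
all covered. -/
theorem sum_merge {M : Type*} [AddCommMonoid M] (g : ℕ → M) (X : List (TableEntry n d)) :
    ((merge X).map fun y => y.cnt • g y.key).sum =
      (X.map fun x => x.cnt • g (x.key + x.t)).sum := by
  induction X using List.reverseRecOn with
  | nil => rfl
  | append_singleton X x ih =>
    rw [merge, List.foldl_append, ← merge, List.foldl_cons, List.foldl_nil, sum_insert, ih]
    simp [add_comm]

theorem total_merge (X : List (TableEntry n d)) : total (merge X) = total X := by
  simpa [total] using sum_merge (fun _ => (1 : ℕ)) X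

theorem nodup_merge (X : List (TableEntry n d)) : ((merge X).map key).Nodup := by
  induction X using List.reverseRecOn with
  | nil => exact List.nodup_nil
  | append_singleton X x ih =>
    rw [merge, List.foldl_append, ← merge, List.foldl_cons, List.foldl_nil, insert_eq,
      List.map_cons, List.nodup_cons, List.map_reverse, List.nodup_reverse]
    refine ⟨?_, ih.sublist (List.filter_sublist.map key)⟩
    simp only [close, List.mem_reverse, List.mem_map, List.mem_filter, not_exists]
    rintro y ⟨⟨-, hy⟩, hy'⟩
    simp [hy'] at hy

/-- Merging alters only multiplicities beyond `close`: a surviving representative is one of the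
given assignments, hence still compatible with the evidence. -/
theorem exists_of_mem_merge {X : List (TableEntry n d)} {y : TableEntry n d}
    (hy : y ∈ merge X) : ∃ x ∈ X, ∃ m, y = { x.close with cnt := m } := by
  induction X using List.reverseRecOn with
  | nil => simp [merge] at hy
  | append_singleton X x ih =>
    rw [merge, List.foldl_append, ← merge, List.foldl_cons, List.foldl_nil, insert_eq,
      List.mem_cons, List.mem_reverse, List.mem_filter] at hy
    rcases hy with rfl | ⟨hy, -⟩
    · exact ⟨x, by simp, _, rfl⟩
    · obtain ⟨x', hx', h⟩ := ih hy
      exact ⟨x', by simp [hx'], h⟩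

theorem cnt_le_total {X : List (TableEntry n d)} {y : TableEntry n d} (hy : y ∈ X) :
    y.cnt ≤ total X :=
  List.le_sum_of_mem (List.mem_map_of_mem hy)

theorem length_merge_le (X : List (TableEntry n d)) : (merge X).length ≤ X.length := by
  induction X using List.reverseRecOn with
  | nil => simp [merge]
  | append_singleton X x ih =>
    rw [merge, List.foldl_append, ← merge, List.foldl_cons, List.foldl_nil, insert_eq]
    have := List.length_filter_le (fun y : TableEntry n d => decide (x.key + x.t ≠ y.key))
      (merge X)
    simp only [List.length_cons, List.length_reverse, List.length_append, List.length_nil]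
    omega

theorem total_le {X : List (TableEntry n d)} {f : ℕ} (hX : ∀ x ∈ X, x.size ≤ f) :
    total X ≤ X.length * 2 ^ f := by
  have := List.sum_le_card_nsmul (X.map cnt) (2 ^ f) (by
    intro m hm
    obtain ⟨x, hx, rfl⟩ := List.mem_map.1 hm
    refine (Nat.lt_size_self _).le.trans (Nat.pow_le_pow_right two_pos ?_)
    exact (Nat.le_add_left _ _).trans (hX x hx))
  simpa [total] using this

/-- A merged multiplicity is at most the total count, which is at most `X.length * 2 ^ f`; a new key
is the sum of an old key and `t`. -/
theorem size_mem_merge_le {X : List (TableEntry n d)} {f : ℕ} (hX : ∀ x ∈ X, x.size ≤ f)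
    {y : TableEntry n d} (hy : y ∈ merge X) : y.size ≤ X.length + 2 * f + 3 := by
  have h1 := (Nat.size_le_size (cnt_le_total hy)).trans
    ((Nat.size_le_size ((total_merge X).trans_le (total_le hX))).trans (Nat.size_mul_le _ _))
  have h2 := Nat.size_le_self X.length
  rw [Nat.size_pow] at h1
  obtain ⟨x, hx, m, rfl⟩ := exists_of_mem_merge hy
  have h3 := hX x hx
  have h4 := Nat.size_add_le x.key x.t
  simp only [size, close, Nat.size_one] at *
  omega

theorem size_assign_le (B : ℕ) (j : Fin n) (x : TableEntry n d) (v : Fin d) :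
    (x.assign B j v).size ≤ (d + 2) * x.size + (d + 1) * Nat.size B + 2 := by
  have h1 := Nat.size_mul_le (x.t ^ (d + 1)) (B ^ (v.val + 1))
  have h2 := Nat.size_pow_le x.t (d + 1)
  have h3 := Nat.size_pow_le B (v.val + 1)
  have h4 : (v.val + 1) * Nat.size B ≤ (d + 1) * Nat.size B := Nat.mul_le_mul_right _ (by omega)
  simp only [size, assign]
  nlinarith [Nat.zero_le ((d + 1) * Nat.size x.key), Nat.zero_le ((d + 1) * Nat.size x.cnt)]

end TableEntry

/-! ## The dynamic program runs in polynomial time -/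

namespace TableEntry

variable {n d : ℕ} {K : Type*} [Field K]

/-- Table entries as trees. -/
def encode (x : TableEntry n d) : Val K :=
  .cons (.num x.key) (.cons (.num x.t) (.cons (.num x.cnt) x.asg.encode))

/-- Tables as trees. -/
def encodeTable (X : List (TableEntry n d)) : Val K := .ofList (X.map encode)

@[simp] theorem height_encode {h : HeightFn K} (x : TableEntry n d) :
    (x.encode : Val K).height h = 0 := rfl

@[simp] theorem height_encodeTable {h : HeightFn K} (X : List (TableEntry n d)) :
    (encodeTable X : Val K).height h = 0 := Val.height_ofList _

/-- A family of tables with few entries of small size. -/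
def Small {I : Type*} (N : I → ℕ) (X : ∀ i, List (TableEntry (N i) d)) : Prop :=
  ∃ f, PolyBdd N f ∧ ∀ i, (X i).length ≤ f i ∧ ∀ x ∈ X i, x.size ≤ f i

namespace Small

variable {I : Type*} {N : I → ℕ} {X : ∀ i, List (TableEntry (N i) d)}

theorem length (H : Small N X) : PolyBdd N fun i => (X i).length :=
  let ⟨_, hf, hX⟩ := H
  hf.mono fun i => (hX i).1

theorem size_elt (H : Small N X) : PolyBdd (fun q : Split X => N q.idx) fun q => q.elt.size :=
  let ⟨_, hf, hX⟩ := H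
  (hf.reindex Split.idx).mono fun q => (hX q.idx).2 _ q.mem

/-- Bounds every accumulator of the merging loop from `X` itself rather than from the preceding
accumulator. -/
theorem merge_pre (H : Small N X) :
    Small (I := Split X) (fun q => N q.idx) fun q => merge q.pre := by
  obtain ⟨f, hf, hX⟩ := H
  refine ⟨fun q => f q.idx + 2 * f q.idx + 3,
    ((hf.add ((PolyBdd.const 2).mul hf)).add (.const 3)).reindex Split.idx, fun q => ?_⟩
  have h1 := (hX q.idx).1
  have h2 := q.prefix.length_le
  refine ⟨(length_merge_le _).trans (by dsimp only; omega), fun y hy => ?_⟩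
  dsimp only
  have := size_mem_merge_le (fun x hx => (hX q.idx).2 x (q.pre_subset hx)) hy
  omega

/-- A bound for the growth of a table when variables are assigned. -/
def growth (d b : ℕ) : ℕ → ℕ → ℕ
  | 0, f => f
  | m + 1, f => growth d b m ((d + 2) * f + (d + 1) * b + 2)

theorem le_growth (d b m f : ℕ) : f ≤ growth d b m f := by
  induction m generalizing f with
  | zero => exact le_rfl
  | succ m ih => exact le_trans (by nlinarith) (ih _)

/-- Since `m` is fixed (it will be the bound `W` on the width), iterating the linear recursion `m`
times keeps the bound polynomial. -/
theorem polyBdd_growth {b f : I → ℕ} (hb : PolyBdd N b) (m : ℕ) (hf : PolyBdd N f) :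
    PolyBdd N fun i => growth d (b i) m (f i) := by
  induction m generalizing f with
  | zero => exact hf
  | succ m ih =>
    exact ih ((((PolyBdd.const _).mul hf).add ((PolyBdd.const _).mul hb)).add (.const _))

theorem foldl_branch_le {B : ℕ} {e : PartialAssignment n d} {c : List (Fin n)} {m f : ℕ}
    (hc : c.length ≤ m) {X : List (TableEntry n d)} (h1 : X.length ≤ f)
    (h2 : ∀ x ∈ X, x.size ≤ f) :
    (c.foldl (branch B e) X).length ≤ growth d (Nat.size B) m f ∧
      ∀ x ∈ c.foldl (branch B e) X, x.size ≤ growth d (Nat.size B) m f := by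
  induction c generalizing m f X with
  | nil => exact ⟨h1.trans (le_growth ..), fun x hx => (h2 x hx).trans (le_growth ..)⟩
  | cons j c ih =>
    obtain ⟨m, rfl⟩ : ∃ m', m = m' + 1 := ⟨m - 1, by simp at hc; omega⟩
    refine ih (m := m) (by simpa using hc) ?_ fun y hy => ?_
    · refine (length_branch_le ..).trans ?_
      nlinarith
    · obtain ⟨x, hx, v, -, rfl⟩ := mem_branch.1 hy
      refine (size_assign_le ..).trans ?_
      have := h2 x hx
      gcongr

theorem foldl_branch {J : Type*} (H : Small N X) {B : I → ℕ}
    (hB : PolyBdd N fun i => Nat.size (B i))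
    (e : ∀ i, PartialAssignment (N i) d) (φ : J → I) (c : ∀ q, List (Fin (N (φ q)))) {W : ℕ}
    (hc : ∀ q, (c q).length ≤ W) :
    Small (fun q => N (φ q)) fun q => (c q).foldl (branch (B (φ q)) (e (φ q))) (X (φ q)) :=
  let ⟨_, hf, hX⟩ := H
  ⟨_, (polyBdd_growth hB W hf).reindex φ,
    fun q => foldl_branch_le (hc q) (hX (φ q)).1 (hX (φ q)).2⟩

end Small

end TableEntry

namespace PolyTime

open PartialAssignment TableEntry

variable {K : Type*} [Field K] [LinearOrder K] {h : HeightFn K} {I : Type*} {N : I → ℕ}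
  {u : I → Val K} {d : ℕ} {e : ∀ i, PartialAssignment (N i) d} {j : ∀ i, Fin (N i)}
  {x : ∀ i, TableEntry (N i) d} {X : ∀ i, List (TableEntry (N i) d)} {B : I → ℕ}

theorem key (hx : PolyTime h N u fun i => (x i).encode) (hxN : PolyBdd N fun i => (x i).size) :
    PolyTime h N u fun i => .num ((x i).key : K) :=
  hx.fst (.ht_natCast (hxN.mono fun i => by simp only [TableEntry.size]; omega))

theorem t (hx : PolyTime h N u fun i => (x i).encode) (hxN : PolyBdd N fun i => (x i).size) :
    PolyTime h N u fun i => .num ((x i).t : K) :=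
  (hx.snd (.const 0)).fst
    (.ht_natCast (hxN.mono fun i => by simp only [TableEntry.size]; omega))

theorem cnt (hx : PolyTime h N u fun i => (x i).encode) (hxN : PolyBdd N fun i => (x i).size) :
    PolyTime h N u fun i => .num ((x i).cnt : K) :=
  ((hx.snd (.const 0)).snd (.const 0)).fst
    (.ht_natCast (hxN.mono fun i => by simp only [TableEntry.size]; omega))

theorem asg (hx : PolyTime h N u fun i => (x i).encode) :
    PolyTime h N u fun i => (x i).asg.encode :=
  ((hx.snd (.const 0)).snd (.const 0)).snd (by simpa using PolyBdd.const 0)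

theorem assign {v : I → Fin d} (hx : PolyTime h N u fun i => (x i).encode)
    (hxN : PolyBdd N fun i => (x i).size) (hB : PolyTime h N u fun i => .num (B i : K))
    (hBN : PolyBdd N fun i => Nat.size (B i)) (hj : PolyTime h N u fun i => .unary (j i).val)
    (hv : PolyTime h N u fun i => .unary ((v i).val + 1)) :
    PolyTime h N u fun i => ((x i).assign (B i) (j i) (v i)).encode := by
  have htN : PolyBdd N fun i => Nat.size (x i).t :=
    hxN.mono fun i => by simp only [TableEntry.size]; omega
  refine (key hx hxN).pair (.pair ?_ ((cnt hx hxN).pair ?_))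
  · refine mul_pow_natCast ?_ hB hv ?_ hBN ((PolyBdd.const (d + 1)).mono fun i => by omega)
    · simpa only [Nat.cast_pow] using (t hx hxN).pow (d + 1)
    · exact (((PolyBdd.const (d + 1)).mul htN).add (.const 1)).mono
        fun i => Nat.size_pow_le _ _
  · exact encode_update (asg hx) hj hv

theorem ofList_const {α : Type*} (f : α → Val K) (hf : ∀ a, PolyTime h N u fun _ => f a)
    (hu : PolyBdd N fun i => (u i).height h) (l : List α) :
    PolyTime h N u fun _ => .ofList (l.map f) := by
  induction l with
  | nil => exact nil hu
  | cons a l ih => exact (hf a).pair ih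

/-- The tree of an assigned entry is already that of its value, so one pairing with `nil` gives the
singleton list. For an unassigned entry the list depends only on `d`, hence is a constant tree. -/
theorem options (he : PolyTime h N u fun i => (e i).encode)
    (hj : PolyTime h N u fun i => .unary (j i).val) :
    PolyTime h N u fun i =>
      .ofList ((options (e i (j i))).map fun v => .unary (v.val + 1)) := by
  have hc := he.encodeEntry hj
  refine hc.ite ?_ ?_
  · refine cast (congrArg _ (funext fun i => ?_))
      ((hc.pair (nil hc.height_left)).reindex Subtype.val)
    have := i.2
    cases ho : e i (j i) with
    | none => simp [PartialAssignment.encodeEntry, ho] at this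
    | some v => rfl
  · refine cast (congrArg _ (funext fun i => ?_)) ((ofList_const (fun v : Fin d =>
      .unary (v.val + 1)) (fun v => unary hc.height_left _) hc.height_left
      (List.finRange d)).reindex Subtype.val)
    have := i.2
    cases ho : e i (j i) with
    | none => rfl
    | some v => simp [PartialAssignment.encodeEntry, ho, Val.unary] at this

theorem foldl_assign (hX : PolyTime h N u fun i => encodeTable (X i))
    (hx : PolyTime h N u fun i => (x i).encode) (hxN : PolyBdd N fun i => (x i).size)
    (he : PolyTime h N u fun i => (e i).encode) (hB : PolyTime h N u fun i => .num (B i : K))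
    (hBN : PolyBdd N fun i => Nat.size (B i)) (hj : PolyTime h N u fun i => .unary (j i).val) :
    PolyTime h N u fun i => encodeTable ((TableEntry.options (e i (j i))).foldl
      (fun acc v => (x i).assign (B i) (j i) v :: acc) (X i)) := by
  refine foldl (es := fun _ => encodeTable) (s₀ := X)
    (f := fun i acc v => (x i).assign (B i) (j i) v :: acc)
    ((PolyBdd.const (d + 1)).mono fun i => length_options_le _)
    (fun _ _ => Val.height_unary _) (options he hj) hX ?_
  refine pair ?_ (var₁ (by simpa using PolyBdd.const 0))
  exact assign (hx.weaken₂ Split.idx _ _) (hxN.reindex Split.idx) (hB.weaken₂ Split.idx _ _)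
    (hBN.reindex Split.idx) (hj.weaken₂ Split.idx _ _) (var₀ (by simpa using PolyBdd.const 0))

theorem branch (hX : PolyTime h N u fun i => encodeTable (X i)) (hXN : Small N X)
    (he : PolyTime h N u fun i => (e i).encode) (hB : PolyTime h N u fun i => .num (B i : K))
    (hBN : PolyBdd N fun i => Nat.size (B i)) (hj : PolyTime h N u fun i => .unary (j i).val) :
    PolyTime h N u fun i => encodeTable (branch (B i) (e i) (X i) (j i)) :=
  foldl (l := X) (es := fun _ => encodeTable) (f := fun i acc (x : TableEntry (N i) d) =>
    (TableEntry.options (e i (j i))).foldl (fun acc v => x.assign (B i) (j i) v :: acc) acc)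
    (s₀ := fun _ => []) hXN.length (fun _ => height_encode) hX (nil hX.height_left)
    (foldl_assign (var₁ (by simpa using PolyBdd.const 0)) (var₀ (.const 0)) hXN.size_elt
      (he.weaken₂ Split.idx _ _) (hB.weaken₂ Split.idx _ _) (hBN.reindex Split.idx)
      (hj.weaken₂ Split.idx _ _))

theorem close (hx : PolyTime h N u fun i => (x i).encode)
    (hxN : PolyBdd N fun i => (x i).size) : PolyTime h N u fun i => (x i).close.encode := by
  simp only [TableEntry.close, TableEntry.encode, Nat.cast_add, Nat.cast_one]
  exact ((key hx hxN).add (t hx hxN)).pair ((one hx.height_left).pair ((cnt hx hxN).pair (asg hx)))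

variable [IsStrictOrderedRing K]

theorem absorb {c s : ∀ i, TableEntry (N i) d} {D : ∀ i, List (TableEntry (N i) d)}
    (hc : PolyTime h N u fun i => .cons (c i).encode (encodeTable (D i)))
    (hcN : PolyBdd N fun i => (c i).size) (hs : PolyTime h N u fun i => (s i).encode)
    (hsN : PolyBdd N fun i => (s i).size) :
    PolyTime h N u fun i => .cons (absorb (c i, D i) (s i)).1.encode
      (encodeTable (TableEntry.absorb (c i, D i) (s i)).2) := by
  have h1 := hc.fst (.const 0)
  have h2 := hc.snd (by simpa using PolyBdd.const 0)
  refine cast (congrArg _ (funext fun i => ?_)) (eq_natCast (key h1 hcN) (key hs hsN)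
    (((key h1 hcN).pair ((t h1 hcN).pair (((cnt h1 hcN).add (cnt hs hsN)).pair
      (asg h1)))).pair h2) (h1.pair (hs.pair h2)))
  simp only [TableEntry.absorb]
  split_ifs
  · simp [TableEntry.encode]
  · rfl

theorem insert (hX : PolyTime h N u fun i => encodeTable (X i)) (hXN : Small N X)
    (hx : PolyTime h N u fun i => (x i).encode) (hxN : PolyBdd N fun i => (x i).size) :
    PolyTime h N u fun i => encodeTable (insert (X i) (x i)) := by
  refine foldl (l := X) (s₀ := fun i => ((x i).close, [])) (f := fun _ => TableEntry.absorb)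
    (es := fun _ c => .cons c.1.encode (encodeTable c.2)) hXN.length (fun _ => height_encode) hX
    ((close hx hxN).pair (nil hX.height_left)) ?_
  refine absorb (var₁ (.const 0)) ?_ (var₀ (.const 0)) hXN.size_elt
  obtain ⟨f, hf, hX⟩ := hXN
  -- `foldl_absorb` gives the current entry after any prefix in closed form, so its size needs no
  -- induction; `10` is slack.
  refine (((((PolyBdd.const 2).mul hxN).add ((PolyBdd.const 2).mul hf)).add
    (.const 10)).reindex Split.idx).mono fun q => ?_
  simp only [foldl_absorb, TableEntry.close, TableEntry.size, Nat.size_one]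
  have h1 := Nat.size_add_le (x q.idx).key (x q.idx).t
  have h2 := Nat.size_add_le (x q.idx).cnt
    (total (q.pre.filter ((x q.idx).key + (x q.idx).t = ·.key)))
  have h3 := (Nat.size_le_size ((total_filter_le q.pre
    ((x q.idx).key + (x q.idx).t = ·.key)).trans
    (total_le fun y hy => (hX q.idx).2 y (q.pre_subset hy)))).trans (Nat.size_mul_le _ _)
  rw [Nat.size_pow] at h3
  have h4 := (Nat.size_le_self _).trans (q.prefix.length_le.trans (hX q.idx).1)
  omega

theorem merge (hX : PolyTime h N u fun i => encodeTable (X i)) (hXN : Small N X) :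
    PolyTime h N u fun i => encodeTable (merge (X i)) :=
  foldl (l := X) (s₀ := fun _ => []) (f := fun _ => TableEntry.insert)
    (es := fun _ => encodeTable) hXN.length (fun _ => height_encode) hX (nil hX.height_left)
    (insert (X := fun q : Split X => TableEntry.merge q.pre)
      (var₁ (by simpa using PolyBdd.const 0)) hXN.merge_pre (var₀ (.const 0)) hXN.size_elt)

theorem step {c : ∀ i, List (Fin (N i))} {W : ℕ}
    (hX : PolyTime h N u fun i => encodeTable (X i)) (hXN : Small N X)
    (he : PolyTime h N u fun i => (e i).encode) (hB : PolyTime h N u fun i => .num (B i : K))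
    (hBN : PolyBdd N fun i => Nat.size (B i))
    (hc : PolyTime h N u fun i => .ofList ((c i).map fun j => .unary j.val))
    (hcW : ∀ i, (c i).length ≤ W) :
    PolyTime h N u fun i => encodeTable (step (B i) (e i) (X i) (c i)) := by
  refine merge ?_ (hXN.foldl_branch hBN e id c hcW)
  refine foldl (l := c) (s₀ := X) (f := fun i => TableEntry.branch (B i) (e i))
    (es := fun _ => encodeTable) ((PolyBdd.const W).mono hcW) (fun _ _ => Val.height_unary _) hc
    hX ?_
  exact branch (var₁ (by simpa using PolyBdd.const 0))
    (hXN.foldl_branch hBN e Split.idx Split.pre fun q => q.prefix.length_le.trans (hcW _))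
    (he.weaken₂ Split.idx _ _) (hB.weaken₂ Split.idx _ _) (hBN.reindex Split.idx)
    (var₀ (by simpa using PolyBdd.const 0))

/-- The number of components is unbounded, so the growth in `step` must not be iterated; `hsmall`
supplies a bound for all intermediate tables at once. -/
theorem table {cs : ∀ i, List (List (Fin (N i)))} {W : ℕ}
    (he : PolyTime h N u fun i => (e i).encode) (hB : PolyTime h N u fun i => .num (B i : K))
    (hBN : PolyBdd N fun i => Nat.size (B i))
    (hcs : PolyTime h N u fun i =>
      .ofList ((cs i).map fun c => .ofList (c.map fun j => .unary j.val)))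
    (hcsN : PolyBdd N fun i => (cs i).length) (hcW : ∀ i, ∀ c ∈ cs i, c.length ≤ W)
    (hsmall : Small (I := Split cs) (fun q => N q.idx)
      fun q => TableEntry.table (B q.idx) (e q.idx) q.pre) :
    PolyTime h N u fun i => encodeTable (table (B i) (e i) (cs i)) := by
  refine foldl (l := cs) (s₀ := fun i => [⟨0, 1, 1, e i⟩])
    (f := fun i => TableEntry.step (B i) (e i)) (es := fun _ => encodeTable) hcsN
    (fun _ _ => Val.height_ofList _) hcs ?_ ?_
  · simp only [encodeTable, List.map_cons, List.map_nil, Val.ofList, TableEntry.encode,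
      Nat.cast_zero, Nat.cast_one]
    have hu := he.height_left
    exact ((zero hu).pair ((one hu).pair ((one hu).pair he))).pair (nil hu)
  · exact step (var₁ (by simpa using PolyBdd.const 0)) hsmall (he.weaken₂ Split.idx _ _)
      (hB.weaken₂ Split.idx _ _) (hBN.reindex Split.idx) (var₀ (by simpa using PolyBdd.const 0))
      fun q => hcW _ _ q.mem

end PolyTime

/-! ## Evaluation of a table -/

namespace TableEntry

variable {n d : ℕ} {K : Type*} [Field K]

/-- The sum of the probabilities of all assignments that a table represents. -/
def weightedSum (pr : PartialAssignment n d → K) (S : List (TableEntry n d)) : K :=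
  S.foldl (fun acc x => acc + x.cnt * pr x.asg) 0

theorem weightedSum_eq (pr : PartialAssignment n d → K) (S : List (TableEntry n d)) :
    weightedSum pr S = (S.map fun x => x.cnt • pr x.asg).sum := by
  induction S using List.reverseRecOn with
  | nil => rfl
  | append_singleton S x ih =>
    rw [weightedSum, List.foldl_append, ← weightedSum, ih]
    simp

/-- Heights are subadditive up to one unit, so each entry adds at most `f + 3` to the accumulator:
one unit each for the cast of `cnt`, the product and the sum. -/
theorem ht_weightedSum_le (h : HeightFn K) {pr : PartialAssignment n d → K}
    {S : List (TableEntry n d)} {f : ℕ} (hS : ∀ x ∈ S, h.ht (pr x.asg) + x.size ≤ f) :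
    h.ht (weightedSum pr S) ≤ S.length * (f + 3) + h.ht 0 := by
  induction S using List.reverseRecOn with
  | nil => simp [weightedSum]
  | append_singleton S x ih =>
    rw [weightedSum, List.foldl_append, ← weightedSum]
    have h1 := ih fun y hy => hS y (by simp [hy])
    have h2 := hS x (by simp)
    have h3 := h.ht_natCast_le x.cnt
    have h4 := h.ht_mul_le (x.cnt : K) (pr x.asg)
    have h5 := h.ht_add_le (weightedSum pr S) (x.cnt * pr x.asg)
    simp only [List.foldl_cons, List.foldl_nil, size, List.length_append, List.length_singleton,
      add_mul, one_mul] at *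
    omega

variable [LinearOrder K]

/-- A representative of largest probability, after its probability. -/
def best (pr : PartialAssignment n d → K) (e : PartialAssignment n d)
    (S : List (TableEntry n d)) : K × PartialAssignment n d :=
  S.foldl (fun p x => if p.1 ≤ pr x.asg then (pr x.asg, x.asg) else p) (0, e)

/-- As the comparison is not strict and probabilities are nonnegative, the first entry always
displaces the initial pair `(0, e)`, even if its probability is zero. -/
theorem best_spec {pr : PartialAssignment n d → K} (hpr : ∀ y, 0 ≤ pr y)
    (e : PartialAssignment n d) (S : List (TableEntry n d)) :
    (S = [] ∧ best pr e S = (0, e)) ∨ (∃ x ∈ S, best pr e S = (pr x.asg, x.asg)) ∧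
      ∀ x ∈ S, pr x.asg ≤ (best pr e S).1 := by
  induction S using List.reverseRecOn with
  | nil => exact .inl ⟨rfl, rfl⟩
  | append_singleton S x ih =>
    right
    rw [best, List.foldl_append, ← best, List.foldl_cons, List.foldl_nil]
    rcases ih with ⟨rfl, h0⟩ | ⟨⟨z, hz, hzb⟩, hle⟩
    · rw [h0, if_pos (hpr _)]
      simp
    · split_ifs with hx
      · refine ⟨⟨x, by simp, rfl⟩, fun y hy => ?_⟩
        rcases List.mem_append.1 hy with hy | hy
        · exact (hle y hy).trans hx
        · rw [List.mem_singleton.1 hy]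
      · refine ⟨⟨z, by simp [hz], hzb⟩, fun y hy => ?_⟩
        rcases List.mem_append.1 hy with hy | hy
        · exact hle y hy
        · rw [List.mem_singleton.1 hy]
          exact (not_le.1 hx).le

end TableEntry

namespace PolyTime

open PartialAssignment TableEntry

variable {K : Type*} [Field K] [LinearOrder K] {h : HeightFn K} {I : Type*} {N : I → ℕ}
  {u w : I → Val K} {d : ℕ} {e : ∀ i, PartialAssignment (N i) d}
  {S : ∀ i, List (TableEntry (N i) d)} {pr : ∀ i, PartialAssignment (N i) d → K}

theorem weightedSum (hS : PolyTime h N u fun i => encodeTable (S i)) (hSN : Small N S)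
    (hw : PolyTime h N u w)
    (hpr : PolyTime h (I := Σ i, {x // x ∈ S i}) (fun q => N q.1)
      (fun q => .cons (w q.1) q.2.1.asg.encode) fun q => .num (pr q.1 q.2.1.asg)) :
    PolyTime h N u fun i => .num (weightedSum (pr i) (S i)) := by
  refine foldl (l := S) (s₀ := fun _ => 0) (f := fun i acc x => acc + x.cnt * pr i x.asg)
    (es := fun _ => .num) hSN.length (fun _ => height_encode) hS (zero hS.height_left) ?_
  have hx := var₀ (h := h) (N := fun q : Split S => N q.idx) (x := fun q => q.elt.encode)
    (u := fun q => Val.cons (.num (TableEntry.weightedSum (pr q.idx) q.pre)) (u q.idx)) (.const 0)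
  refine add (var₁ ?_) ((cnt hx hSN.size_elt).mul
    (((hw.weaken₂ Split.idx _ _).pair (asg hx)).comp
      (hpr.reindex fun q : Split S => ⟨q.idx, q.elt, q.mem⟩)))
  obtain ⟨f, hf, hSf⟩ := hSN
  obtain ⟨p, hp⟩ := hpr.height
  have hpN : PolyBdd N fun i => p.eval (N i) := ⟨p, fun _ => le_rfl⟩
  refine ((((hf.mul ((hpN.add hf).add (.const 3)))).add (.const (h.ht 0))).reindex
    Split.idx).mono fun q => (ht_weightedSum_le (f := p.eval (N q.idx) + f q.idx) h
      fun x hx => ?_).trans ?_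
  · exact add_le_add (hp ⟨q.idx, x, q.pre_subset hx⟩) ((hSf q.idx).2 x (q.pre_subset hx))
  · have := q.prefix.length_le.trans (hSf q.idx).1
    gcongr

theorem best [IsStrictOrderedRing K] (hpr0 : ∀ i y, 0 ≤ pr i y)
    (hS : PolyTime h N u fun i => encodeTable (S i)) (hSN : Small N S)
    (hw : PolyTime h N u w) (he : PolyTime h N u fun i => (e i).encode)
    (hpr : PolyTime h (I := Σ i, {x // x ∈ S i}) (fun q => N q.1)
      (fun q => .cons (w q.1) q.2.1.asg.encode) fun q => .num (pr q.1 q.2.1.asg)) :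
    PolyTime h N u fun i => (best (pr i) (e i) (S i)).2.encode := by
  suffices PolyTime h N u fun i => .cons (.num (TableEntry.best (pr i) (e i) (S i)).1)
      (TableEntry.best (pr i) (e i) (S i)).2.encode from
    this.snd (by simpa using PolyBdd.const 0)
  refine foldl (l := S) (s₀ := fun i => (0, e i)) (es := fun _ p => .cons (.num p.1) p.2.encode)
    (f := fun i p x => if p.1 ≤ pr i x.asg then (pr i x.asg, x.asg) else p)
    hSN.length (fun _ => height_encode) hS ((zero hS.height_left).pair he) ?_
  change PolyTime h (fun q : Split S => N q.idx) (fun q => .cons q.elt.encode (.cons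
    (.cons (.num (TableEntry.best (pr q.idx) (e q.idx) q.pre).1)
      (TableEntry.best (pr q.idx) (e q.idx) q.pre).2.encode) (u q.idx))) fun q => .cons
    (.num (if (TableEntry.best (pr q.idx) (e q.idx) q.pre).1 ≤ pr q.idx q.elt.asg then
      (pr q.idx q.elt.asg, q.elt.asg) else TableEntry.best (pr q.idx) (e q.idx) q.pre).1)
    (if (TableEntry.best (pr q.idx) (e q.idx) q.pre).1 ≤ pr q.idx q.elt.asg then
      (pr q.idx q.elt.asg, q.elt.asg) else TableEntry.best (pr q.idx) (e q.idx) q.pre).2.encode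
  have hx := var₀ (h := h) (N := fun q : Split S => N q.idx) (x := fun q => q.elt.encode)
    (u := fun q => Val.cons (.cons (.num (TableEntry.best (pr q.idx) (e q.idx) q.pre).1)
      (TableEntry.best (pr q.idx) (e q.idx) q.pre).2.encode) (u q.idx)) (.const 0)
  have hb := var₁ (h := h) (N := fun q : Split S => N q.idx) (x := fun q => q.elt.encode)
    (y := fun q => Val.cons (.num (TableEntry.best (pr q.idx) (e q.idx) q.pre).1)
      (TableEntry.best (pr q.idx) (e q.idx) q.pre).2.encode) (u := fun q => u q.idx) (.const 0)
  have hp := ((hw.weaken₂ Split.idx (fun q => q.elt.encode) fun q => Val.cons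
    (.num (TableEntry.best (pr q.idx) (e q.idx) q.pre).1)
      (TableEntry.best (pr q.idx) (e q.idx) q.pre).2.encode).pair (asg hx)).comp
      (hpr.reindex fun q : Split S => ⟨q.idx, q.elt, q.mem⟩)
  -- The number kept so far is `0` or the probability of an earlier entry, so its height is bounded.
  have hb1 := hb.fst (by
    obtain ⟨p, hp⟩ := hpr.height
    refine PolyBdd.mono (g := fun q => p.eval (N q.idx) + h.ht 0)
      ⟨p + Polynomial.C (h.ht 0), fun q => by simp⟩ fun q => ?_
    rcases best_spec (hpr0 q.idx) (e q.idx) q.pre with ⟨-, hq⟩ | ⟨⟨x, hx, hq⟩, -⟩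
    · simp [hq]
    · rw [hq]
      exact (hp ⟨q.idx, x, q.pre_subset hx⟩).trans (Nat.le_add_right _ _))
  refine cast (congrArg _ (funext fun q => ?_)) (ite_prop (hb1.le hp) (hp.pair (asg hx)) hb)
  split_ifs <;> rfl

end PolyTime

/-! ## Correctness of the dynamic program -/

namespace PartialAssignment

variable {n d : ℕ}

/-- The digit of an entry of a partial assignment. -/
def digit (o : Option (Fin d)) : ℕ := o.elim 0 fun v => v.val + 1

theorem digit_lt (o : Option (Fin d)) : digit o < d + 1 := by
  cases o <;> simp [digit]

theorem digit_injective : Function.Injective (digit (d := d)) := by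
  rintro (_ | v) (_ | w) h
  · rfl
  · simp [digit] at h
  · simp [digit] at h
  · simpa [digit, Fin.ext_iff] using h

/-- The values of a list of variables, as one number. -/
def code (y : PartialAssignment n d) (c : List (Fin n)) : ℕ :=
  c.foldl (fun m j => (d + 1) * m + digit (y j)) 0

theorem code_concat (y : PartialAssignment n d) (c : List (Fin n)) (j : Fin n) :
    code y (c ++ [j]) = (d + 1) * code y c + digit (y j) := by
  simp [code]

theorem code_congr {y y' : PartialAssignment n d} {c : List (Fin n)}
    (h : ∀ j ∈ c, y j = y' j) : code y c = code y' c := by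
  induction c using List.reverseRecOn with
  | nil => rfl
  | append_singleton c j ih =>
    rw [code_concat, code_concat, ih fun i hi => h i (by simp [hi]), h j (by simp)]

theorem code_lt (y : PartialAssignment n d) (c : List (Fin n)) :
    code y c < (d + 1) ^ c.length := by
  induction c using List.reverseRecOn with
  | nil => simp [code]
  | append_singleton c j ih =>
    rw [code_concat, List.length_append, List.length_singleton, pow_succ]
    have := digit_lt (y j)
    nlinarith

/-- The last digit is the remainder modulo `d + 1`, the rest the quotient. Since `none` has digit
`0`, leading digits could get lost if the lengths differed. -/
theorem code_injective {y y' : PartialAssignment n d} :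
    ∀ {c c' : List (Fin n)}, c.length = c'.length → code y c = code y' c' →
      c.map y = c'.map y' := by
  intro c
  induction c using List.reverseRecOn with
  | nil =>
    intro c' hl _
    rw [List.eq_nil_of_length_eq_zero hl.symm]
    rfl
  | append_singleton c j ih =>
    intro c' hl hc
    rcases List.eq_nil_or_concat c' with rfl | ⟨c', j', rfl⟩
    · simp at hl
    rw [List.concat_eq_append] at *
    rw [code_concat, code_concat] at hc
    have h1 := digit_lt (y j)
    have h2 := digit_lt (y' j')
    have h3 : code y c = code y' c' := by
      have := congrArg (· / (d + 1)) hc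
      simpa [Nat.mul_add_div, Nat.div_eq_of_lt, h1, h2] using this
    rw [h3] at hc
    rw [List.map_append, List.map_append, ih (by simpa using hl) h3, List.map_singleton,
      List.map_singleton, digit_injective (Nat.add_left_cancel hc)]

/-- `y` assigns to the variables in `P` values that the evidence admits, and agrees with the
evidence on all other variables. -/
def Completes (e : PartialAssignment n d) (P : List (Fin n)) (y : PartialAssignment n d) : Prop :=
  ∀ j, (j ∉ P → y j = e j) ∧ (j ∈ P → ∃ v ∈ TableEntry.options (e j), y j = some v)

end PartialAssignment

namespace TableEntry

open PartialAssignment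

variable {n d : ℕ} {B : ℕ} {e : PartialAssignment n d}

@[simp] theorem asg_assign (j : Fin n) (x : TableEntry n d) (v : Fin d) :
    (x.assign B j v).asg = Function.update x.asg j (some v) := rfl

theorem mem_options {o : Option (Fin d)} {v : Fin d} :
    v ∈ options o ↔ ∀ w, o = some w → v = w := by
  cases o <;> simp [options]

/-- The entry `x` represents the values that it assigns to the components in `cs` and to the
initial part `c` of another component. -/
structure Represents (B : ℕ) (e : PartialAssignment n d) (cs : List (List (Fin n)))
    (c : List (Fin n)) (x : TableEntry n d) : Prop where
  key : x.key = (cs.map fun c => B ^ code x.asg c).sum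
  t : x.t = B ^ code x.asg c
  completes : Completes e (cs.flatten ++ c) x.asg

/-- As `j` is new, no earlier code changes. Appending the digit `v + 1` turns a code `m` into `(d +
1) * m + (v + 1)`, so `B ^ m` is raised to the power `d + 1` and multiplied by `B ^ (v + 1)`. -/
theorem Represents.assign {cs : List (List (Fin n))} {c : List (Fin n)} {x : TableEntry n d}
    (hx : Represents B e cs c x) {j : Fin n} (hj : j ∉ cs.flatten ++ c) {v : Fin d}
    (hv : v ∈ options (e j)) : Represents B e cs (c ++ [j]) (x.assign B j v) where
  key := by
    refine hx.key.trans (congrArg List.sum (List.map_congr_left fun c' hc' => ?_))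
    rw [code_congr fun i hi => ?_]
    rw [asg_assign, Function.update_of_ne]
    rintro rfl
    exact hj (List.mem_append_left _ (List.mem_flatten.2 ⟨c', hc', hi⟩))
  t := by
    have : code (Function.update x.asg j (some v)) c = code x.asg c := by
      refine code_congr fun i hi => ?_
      rw [Function.update_of_ne]
      rintro rfl
      exact hj (List.mem_append_right _ hi)
    rw [code_concat, asg_assign, this, Function.update_self, pow_add, mul_comm (d + 1), pow_mul,
      ← hx.t]
    rfl
  completes i := by
    rw [← List.append_assoc, List.mem_append, List.mem_singleton, asg_assign]
    by_cases hi : i = j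
    · subst hi
      exact ⟨fun h => absurd (.inr rfl) h, fun _ => ⟨v, hv, Function.update_self ..⟩⟩
    · rw [Function.update_of_ne hi]
      simpa [hi] using hx.completes i

theorem Represents.close {cs : List (List (Fin n))} {c : List (Fin n)} {x : TableEntry n d}
    (hx : Represents B e cs c x) (m : ℕ) :
    Represents B e (cs ++ [c]) [] { x.close with cnt := m } where
  key := by simp [TableEntry.close, hx.key, hx.t]
  t := by simp [TableEntry.close, code]
  completes := by simpa [TableEntry.close] using hx.completes

theorem represents_foldl_branch {cs : List (List (Fin n))} {c c' : List (Fin n)}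
    {X : List (TableEntry n d)} (hnd : (cs.flatten ++ (c' ++ c)).Nodup)
    (hX : ∀ x ∈ X, Represents B e cs c' x) :
    ∀ x ∈ c.foldl (branch B e) X, Represents B e cs (c' ++ c) x := by
  induction c generalizing c' X with
  | nil => simpa using hX
  | cons j c ih =>
    have := ih (c' := c' ++ [j]) (X := branch B e X j) (by simpa using hnd) (by
      intro y hy
      obtain ⟨x, hx, v, hv, rfl⟩ := mem_branch.1 hy
      refine (hX x hx).assign ?_ hv
      rw [← List.append_assoc] at hnd
      exact fun h => List.disjoint_of_nodup_append hnd h List.mem_cons_self)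
    simpa using this

/-- The dynamic program with an arbitrary operation `post` at the end of each component. -/
def run (post : List (TableEntry n d) → List (TableEntry n d)) (B : ℕ)
    (e : PartialAssignment n d) (cs : List (List (Fin n))) : List (TableEntry n d) :=
  cs.foldl (fun S c => post (c.foldl (branch B e) S)) [⟨0, 1, 1, e⟩]

theorem run_concat (post : List (TableEntry n d) → List (TableEntry n d))
    (cs : List (List (Fin n))) (c : List (Fin n)) :
    run post B e (cs ++ [c]) = post (c.foldl (branch B e) (run post B e cs)) := by
  simp [run]

theorem run_merge (cs : List (List (Fin n))) : run merge B e cs = table B e cs := rfl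

/-- `hpost` is what `merge` and `List.map close` have in common; both enumerations share this
induction. -/
theorem represents_run {post : List (TableEntry n d) → List (TableEntry n d)}
    (hpost : ∀ X, ∀ y ∈ post X, ∃ x ∈ X, ∃ m, y = { x.close with cnt := m })
    {cs : List (List (Fin n))} (hnd : cs.flatten.Nodup) :
    ∀ x ∈ run post B e cs, Represents B e cs [] x := by
  induction cs using List.reverseRecOn with
  | nil =>
    intro x hx
    obtain rfl := List.mem_singleton.1 hx
    exact ⟨rfl, by simp [code], fun j => ⟨fun _ => rfl, fun h => by simp at h⟩⟩
  | append_singleton cs c ih =>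
    intro y hy
    rw [run_concat] at hy
    have hnd' : (cs.flatten ++ c).Nodup := by simpa using hnd
    obtain ⟨x, hx, m, rfl⟩ := hpost _ _ hy
    exact (represents_foldl_branch (c' := []) (by simpa using hnd')
      (ih hnd'.of_append_left) x hx).close m

theorem represents_table {cs : List (List (Fin n))} (hnd : cs.flatten.Nodup) :
    ∀ x ∈ table B e cs, Represents B e cs [] x :=
  represents_run (post := merge) (fun _ _ hy => exists_of_mem_merge hy) hnd

/-- The list of all assignments that the evidence admits. -/
def full (B : ℕ) (e : PartialAssignment n d) (cs : List (List (Fin n))) :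
    List (TableEntry n d) :=
  run (List.map close) B e cs

theorem represents_full {cs : List (List (Fin n))} (hnd : cs.flatten.Nodup) :
    ∀ x ∈ full B e cs, Represents B e cs [] x := by
  refine represents_run (fun X y hy => ?_) hnd
  obtain ⟨x, hx, rfl⟩ := List.mem_map.1 hy
  exact ⟨x, hx, x.cnt, rfl⟩

theorem cnt_foldl_branch {X : List (TableEntry n d)} (hX : ∀ x ∈ X, x.cnt = 1)
    (c : List (Fin n)) : ∀ x ∈ c.foldl (branch B e) X, x.cnt = 1 := by
  induction c generalizing X with
  | nil => exact hX
  | cons j c ih =>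
    refine ih fun y hy => ?_
    obtain ⟨x, hx, v, -, rfl⟩ := mem_branch.1 hy
    exact hX x hx

theorem cnt_full (cs : List (List (Fin n))) : ∀ x ∈ full B e cs, x.cnt = 1 := by
  induction cs using List.reverseRecOn with
  | nil => simp [full, run]
  | append_singleton cs c ih =>
    intro y hy
    rw [full, run_concat, ← full] at hy
    obtain ⟨x, hx, rfl⟩ := List.mem_map.1 hy
    exact cnt_foldl_branch ih c x hx

section Sums

variable {M : Type*} [AddCommMonoid M]

/-- The sum of a function of the numbers of an entry over a table. -/
def tableSum (G : ℕ → ℕ → M) (X : List (TableEntry n d)) : M :=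
  (X.map fun x => x.cnt • G x.key x.t).sum

/-- The options depend on `j` and the evidence but not on the entry, so branching acts on the pair
(`key`, `t`) alone. This is why early merging does no harm. -/
theorem tableSum_branch (G : ℕ → ℕ → M) (X : List (TableEntry n d)) (j : Fin n) :
    tableSum G (branch B e X j) = tableSum (fun k t => ((options (e j)).map fun v =>
      G k (t ^ (d + 1) * B ^ (v.val + 1))).sum) X := by
  rw [tableSum, sum_branch, tableSum]
  simp only [List.smul_sum, List.map_map]
  rfl

theorem tableSum_foldl_branch {X X' : List (TableEntry n d)}
    (hX : ∀ G : ℕ → ℕ → M, tableSum G X = tableSum G X') (c : List (Fin n)) (G : ℕ → ℕ → M) :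
    tableSum G (c.foldl (branch B e) X) = tableSum G (c.foldl (branch B e) X') := by
  induction c generalizing X X' with
  | nil => exact hX G
  | cons j c ih => exact ih fun G => by rw [tableSum_branch, tableSum_branch, hX]

/-- Merging entries does not change sums over tables. -/
theorem tableSum_table (cs : List (List (Fin n))) (G : ℕ → ℕ → M) :
    tableSum G (table B e cs) = tableSum G (full B e cs) := by
  induction cs using List.reverseRecOn generalizing G with
  | nil => rfl
  | append_singleton cs c ih =>
    rw [full, ← run_merge, run_concat, run_concat, ← full, run_merge]
    have h1 : ∀ X : List (TableEntry n d),
        tableSum G (merge X) = tableSum (fun k t => G (k + t) 1) X := by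
      intro X
      refine Eq.trans ?_ (sum_merge (fun k => G k 1) X)
      refine congrArg List.sum (List.map_congr_left fun y hy => ?_)
      obtain ⟨x, -, m, rfl⟩ := exists_of_mem_merge hy
      rfl
    rw [h1, tableSum_foldl_branch ih, tableSum, tableSum, List.map_map]
    rfl

end Sums

/-- A function that is additive over the values of each unassigned variable is additive over the
list of all assignments. -/
theorem sum_full {M : Type*} [AddCommMonoid M] {μ : PartialAssignment n d → M}
    (hμ : ∀ y j, y j = none → ∑ v, μ (Function.update y j (some v)) = μ y)
    {cs : List (List (Fin n))} (hnd : cs.flatten.Nodup) :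
    ((full B e cs).map fun x => μ x.asg).sum = μ e := by
  have key : ∀ (c c' : List (Fin n)) (cs : List (List (Fin n))) (X : List (TableEntry n d)),
      (cs.flatten ++ (c' ++ c)).Nodup → (∀ x ∈ X, Represents B e cs c' x) →
      ((c.foldl (branch B e) X).map fun x => μ x.asg).sum = (X.map fun x => μ x.asg).sum := by
    intro c
    induction c with
    | nil => intros; rfl
    | cons j c ih =>
      intro c' cs X hnd hX
      have hj : j ∉ cs.flatten ++ c' := by
        rw [← List.append_assoc] at hnd
        exact fun h => List.disjoint_of_nodup_append hnd h List.mem_cons_self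
      rw [List.foldl_cons, ih (c' ++ [j]) cs _ (by simpa using hnd), sum_branch]
      · refine congrArg List.sum (List.map_congr_left fun x hx => ?_)
        have hxj := ((hX x hx).completes j).1 hj
        simp only [asg_assign]
        -- An unassigned variable is split into all its values, where `hμ` applies; for a variable
        -- in the evidence, the assignment rewrites the value that is already there.
        cases hej : e j with
        | none =>
          rw [← hμ x.asg j (hxj.trans hej), Fin.sum_univ_def]
          rfl
        | some v =>
          have : Function.update x.asg j (some v) = x.asg := by
            rw [← hej, ← hxj, Function.update_eq_self]
          simp [options, this]
      · intro y hy
        obtain ⟨x, hx, v, hv, rfl⟩ := mem_branch.1 hy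
        exact (hX x hx).assign hj hv
  induction cs using List.reverseRecOn with
  | nil => simp [full, run]
  | append_singleton cs c ih =>
    have hnd' : (cs.flatten ++ c).Nodup := by simpa using hnd
    rw [full, run_concat, ← full, List.map_map]
    refine Eq.trans ?_ (ih hnd'.of_append_left)
    exact key c [] cs _ (by simpa using hnd') (represents_full hnd'.of_append_left)

/-- At every branching, follow the entry that takes the value given by `y`. -/
theorem exists_mem_full {y : PartialAssignment n d} {cs : List (List (Fin n))}
    (hnd : cs.flatten.Nodup) (hy : Completes e cs.flatten y) :
    ∃ x ∈ full B e cs, x.asg = y := by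
  have key : ∀ (c P : List (Fin n)) (X : List (TableEntry n d)),
      (∀ j ∈ c, ∃ v ∈ options (e j), y j = some v) → (∃ x ∈ X, ∀ j ∈ P, x.asg j = y j) →
      ∃ x ∈ c.foldl (branch B e) X, ∀ j ∈ P ++ c, x.asg j = y j := by
    intro c
    induction c with
    | nil => intro P X _ h; simpa using h
    | cons j c ih =>
      rintro P X hc ⟨x, hx, hxP⟩
      obtain ⟨v, hv, hyv⟩ := hc j List.mem_cons_self
      have := ih (P ++ [j]) (branch B e X j) (fun i hi => hc i (List.mem_cons_of_mem _ hi))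
        ⟨x.assign B j v, mem_branch.2 ⟨x, hx, v, hv, rfl⟩, fun i hi => by
          by_cases hij : i = j
          · subst hij
            simp [hyv]
          · rw [asg_assign, Function.update_of_ne hij]
            exact hxP i (by simpa [hij] using hi)⟩
      simpa using this
  have key' : ∀ cs : List (List (Fin n)), (∀ j ∈ cs.flatten, ∃ v ∈ options (e j), y j = some v) →
      ∃ x ∈ full B e cs, ∀ j ∈ cs.flatten, x.asg j = y j := by
    intro cs
    induction cs using List.reverseRecOn with
    | nil => simp [full, run]
    | append_singleton cs c ih =>
      intro h
      simp only [List.flatten_append, List.flatten_singleton, List.mem_append] at h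
      obtain ⟨x, hx, hxc⟩ := key c cs.flatten _ (fun j hj => h j (.inr hj))
        (ih fun j hj => h j (.inl hj))
      refine ⟨x.close, ?_, by simpa [close] using hxc⟩
      rw [full, run_concat]
      exact List.mem_map_of_mem hx
  obtain ⟨x, hx, hxy⟩ := key' cs fun j hj => (hy j).2 hj
  refine ⟨x, hx, funext fun j => ?_⟩
  by_cases hj : j ∈ cs.flatten
  · exact hxy j hj
  · rw [(hy j).1 hj, ((represents_full hnd x hx).completes j).1 (by simpa using hj)]

/-- The sum of the indicator of the key of `x` is the same over both lists. It is positive over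
`full`, so some entry of the table has this key. -/
theorem exists_mem_table {cs : List (List (Fin n))} {x : TableEntry n d}
    (hx : x ∈ full B e cs) : ∃ s ∈ table B e cs, s.key = x.key := by
  by_contra! h
  have h1 := tableSum_table (B := B) (e := e) cs fun k _ => if k = x.key then 1 else 0
  have h2 : tableSum (fun k _ => if k = x.key then 1 else 0) (table B e cs) = 0 := by
    refine List.sum_eq_zero fun m hm => ?_
    obtain ⟨s, hs, rfl⟩ := List.mem_map.1 hm
    simp [h s hs]
  have h3 := List.le_sum_of_mem (List.mem_map_of_mem
    (f := fun x' => x'.cnt • if x'.key = x.key then 1 else 0) hx)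
  rw [h2] at h1
  simp only [tableSum] at h1
  rw [← h1] at h3
  simp [cnt_full cs x hx] at h3

/-! ### A priori bounds for the tables. -/

theorem total_foldl_branch_le (X : List (TableEntry n d)) (c : List (Fin n)) :
    total (c.foldl (branch B e) X) ≤ (d + 1) ^ c.length * total X := by
  induction c generalizing X with
  | nil => simp
  | cons j c ih =>
    refine (ih _).trans ?_
    rw [List.length_cons, pow_succ, mul_assoc]
    exact Nat.mul_le_mul_left _ (total_branch_le ..)

theorem total_table_le (cs : List (List (Fin n))) :
    total (table B e cs) ≤ (d + 1) ^ cs.flatten.length := by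
  induction cs using List.reverseRecOn with
  | nil => simp [table, total]
  | append_singleton cs c ih =>
    rw [← run_merge, run_concat, total_merge, run_merge]
    refine (total_foldl_branch_le _ _).trans ?_
    simp only [List.flatten_append, List.flatten_singleton, List.length_append]
    rw [add_comm cs.flatten.length, pow_add]
    exact Nat.mul_le_mul_left _ ih

theorem nodup_table (cs : List (List (Fin n))) : ((table B e cs).map key).Nodup := by
  rcases List.eq_nil_or_concat cs with rfl | ⟨cs, c, rfl⟩
  · simp [table]
  · rw [List.concat_eq_append, ← run_merge, run_concat]
    exact nodup_merge _

theorem Represents.key_le {cs : List (List (Fin n))} {c : List (Fin n)} {x : TableEntry n d}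
    (hx : Represents B e cs c x) (hB : 0 < B) {W : ℕ} (hW : ∀ c ∈ cs, c.length ≤ W) :
    x.key ≤ cs.length * B ^ (d + 1) ^ W := by
  rw [hx.key]
  have := List.sum_le_card_nsmul (cs.map fun c => B ^ code x.asg c) (B ^ (d + 1) ^ W) (by
    intro m hm
    obtain ⟨c, hc, rfl⟩ := List.mem_map.1 hm
    exact Nat.pow_le_pow_right hB ((code_lt _ _).le.trans
      (Nat.pow_le_pow_right (Nat.succ_pos d) (hW c hc))))
  simpa using this

/-- The keys are distinct natural numbers of polynomial size, hence few. This is where bounded width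
enters: `(d + 1) ^ W` is a constant exponent. -/
theorem length_table_le {cs : List (List (Fin n))} (hnd : cs.flatten.Nodup) (hB : 0 < B) {W : ℕ}
    (hW : ∀ c ∈ cs, c.length ≤ W) :
    (table B e cs).length ≤ cs.length * B ^ (d + 1) ^ W + 1 := by
  rw [← List.length_map (f := key), ← List.toFinset_card_of_nodup (nodup_table cs)]
  refine (Finset.card_le_card fun k hk => ?_).trans (Finset.card_range _).le
  obtain ⟨x, hx, rfl⟩ := List.mem_map.1 (List.mem_toFinset.1 hk)
  rw [Finset.mem_range, Nat.lt_succ_iff]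
  exact (represents_table hnd x hx).key_le hB hW

/-- The three outer summands bound `key`, `t` and `cnt`; between components `t = 1`. -/
theorem size_table_le {cs : List (List (Fin n))} (hnd : cs.flatten.Nodup) (hB : 0 < B) {W : ℕ}
    (hW : ∀ c ∈ cs, c.length ≤ W) {x : TableEntry n d} (hx : x ∈ table B e cs) :
    x.size ≤ cs.length + ((d + 1) ^ W * Nat.size B + 1) + 1 +
      (cs.flatten.length * Nat.size (d + 1) + 1) := by
  have hr := represents_table hnd x hx
  refine Nat.add_le_add (Nat.add_le_add ?_ ?_) ?_
  · exact (Nat.size_le_size (hr.key_le hB hW)).trans ((Nat.size_mul_le _ _).trans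
      (Nat.add_le_add (Nat.size_le_self _) (Nat.size_pow_le _ _)))
  · simp [hr.t, code]
  · exact (Nat.size_le_size ((cnt_le_total hx).trans (total_table_le cs))).trans
      (Nat.size_pow_le _ _)

end TableEntry

/-! ## Uniqueness of digits and exchangeability -/

theorem Nat.digits_unique {B : ℕ} {f g : ℕ → ℕ} (hf : ∀ a, f a < B) (hg : ∀ a, g a < B) {m : ℕ}
    (h : ∑ a ∈ Finset.range m, f a * B ^ a = ∑ a ∈ Finset.range m, g a * B ^ a) :
    ∀ a < m, f a = g a := by
  have hlt : ∀ f : ℕ → ℕ, (∀ a, f a < B) → ∀ m, ∑ a ∈ Finset.range m, f a * B ^ a < B ^ m := by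
    intro f hf m
    induction m with
    | zero => simp
    | succ m ih =>
      rw [Finset.sum_range_succ, pow_succ]
      have := Nat.mul_le_mul_right (B ^ m) (hf m)
      rw [Nat.succ_mul, mul_comm B] at this
      have := ih
      omega
  induction m with
  | zero => intro a ha; omega
  | succ m ih =>
    rw [Finset.sum_range_succ, Finset.sum_range_succ] at h
    have h1 := hlt f hf m
    have h2 := hlt g hg m
    have h3 : f m = g m := by
      have := congrArg (· / B ^ m) h
      have hB : 0 < B ^ m := by omega
      simpa [Nat.add_mul_div_right, hB, Nat.div_eq_of_lt, h1, h2] using this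
    rw [h3] at h
    intro a ha
    rcases Nat.lt_succ_iff_lt_or_eq.1 ha with ha | rfl
    · exact ih (Nat.add_right_cancel h) a ha
    · exact h3

/-- A family of fewer than `B` numbers is determined by the sum of the corresponding powers of
`B`, up to a permutation. -/
theorem exists_perm_of_sum_pow_eq {ι : Type*} [Fintype ι] {B : ℕ} (hB : Fintype.card ι < B)
    {f g : ι → ℕ} (h : ∑ l, B ^ f l = ∑ l, B ^ g l) : ∃ π : Equiv.Perm ι, ∀ l, g (π l) = f l := by
  classical
  obtain ⟨m, hm⟩ : ∃ m, ∀ l, f l < m ∧ g l < m := by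
    refine ⟨∑ l, (f l + g l) + 1, fun l => ?_⟩
    have := Finset.single_le_sum (f := fun l => f l + g l) (fun _ _ => Nat.zero_le _)
      (Finset.mem_univ l)
    omega
  have key : ∀ f : ι → ℕ, (∀ l, f l < m) →
      ∑ l, B ^ f l = ∑ a ∈ Finset.range m, Fintype.card {l // f l = a} * B ^ a := by
    intro f hf
    rw [← Finset.sum_fiberwise_of_maps_to (t := Finset.range m) (g := f)
      fun l _ => Finset.mem_range.2 (hf l)]
    refine Finset.sum_congr rfl fun a _ => ?_
    rw [Finset.sum_congr rfl fun l hl => by rw [(Finset.mem_filter.1 hl).2], Finset.sum_const,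
      Fintype.card_subtype, smul_eq_mul]
  rw [key f fun l => (hm l).1, key g fun l => (hm l).2] at h
  -- The digit at `B ^ a` is the size of the fibre over `a`. It is less than `B`, so no carries
  -- occur, and fibres of equal sizes can be matched.
  have hcard : ∀ a, Fintype.card {l // f l = a} = Fintype.card {l // g l = a} := by
    intro a
    by_cases ha : a < m
    · exact Nat.digits_unique (fun a => (Fintype.card_subtype_le _).trans_lt hB)
        (fun a => (Fintype.card_subtype_le _).trans_lt hB) h a ha
    · rw [Fintype.card_eq_zero_iff.2 ⟨fun l => ha (by rw [← l.2]; exact (hm l.1).1)⟩,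
        Fintype.card_eq_zero_iff.2 ⟨fun l => ha (by rw [← l.2]; exact (hm l.1).2)⟩]
  exact ⟨Equiv.ofFiberEquiv fun a => Fintype.equivOfCardEq (hcard a),
    fun l => Equiv.ofFiberEquiv_map _ l⟩

namespace Model

open PartialAssignment

variable {K : Type*} [Field K] [LinearOrder K] {d : ℕ} (M : Model K d)

/-- The components, as lists. -/
def components : List (List (Fin M.n)) := List.ofFn fun l => List.ofFn (M.component l)

theorem mem_flatten_components {i : Fin M.n} : i ∈ M.components.flatten ↔ i ∈ M.Y := by
  simp [components, List.mem_flatten, List.mem_ofFn, M.mem_Y_iff]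

theorem nodup_flatten_components : M.components.flatten.Nodup := by
  rw [List.nodup_flatten]
  refine ⟨fun c hc => ?_, ?_⟩
  · obtain ⟨l, rfl⟩ := (List.mem_ofFn' _ _).1 hc
    refine List.nodup_ofFn.2 fun j j' h => ?_
    exact congrArg Prod.snd (@M.component_injective (l, j) (l, j') h)
  · refine List.pairwise_ofFn.2 fun l l' hl i hi hi' => ?_
    obtain ⟨j, rfl⟩ := (List.mem_ofFn' _ _).1 hi
    obtain ⟨j', h⟩ := (List.mem_ofFn' _ _).1 hi'
    exact hl.ne (congrArg Prod.fst (@M.component_injective (l, j) (l', j') h.symm))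

/-- The components are disjoint and, by `width_pos`, nonempty, so their first variables are
distinct. -/
theorem length_components_le : M.components.length ≤ M.n := by
  have h : Function.Injective fun l => M.component l ⟨0, M.width_pos⟩ := fun l l' h =>
    congrArg Prod.fst (@M.component_injective (l, _) (l', _) h)
  simpa [components] using Fintype.card_le_of_injective _ h

variable {M}

theorem marginal_eq_pr {y : PartialAssignment M.n d} (hy : ∀ j ∉ M.Y, y j = none)
    {a : Fin M.k → Fin M.width → Fin d} (ha : ∀ l j, y (M.component l j) = some (a l j)) :
    M.marginal y = M.pr {x | ∀ l j, x (M.component l j) = a l j} := by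
  rw [marginal]
  congr 1
  ext x
  refine ⟨fun h l j => h _ _ (ha l j), fun h i v hv => ?_⟩
  by_cases hi : i ∈ M.Y
  · obtain ⟨l, j, rfl⟩ := (M.mem_Y_iff i).1 hi
    rw [h, ← Option.some_inj, ← ha, hv]
  · simp [hy i hi] at hv

/-- Assignments with the same key have the same probability. -/
theorem MarginallyExchangeable.marginal_eq (H : M.MarginallyExchangeable)
    {y y' : PartialAssignment M.n d} (hy : y.IsAssignmentOf M.Y) (hy' : y'.IsAssignmentOf M.Y)
    {B : ℕ} (hB : M.n < B) (h : (M.components.map fun c => B ^ code y c).sum =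
      (M.components.map fun c => B ^ code y' c).sum) : M.marginal y = M.marginal y' := by
  simp only [components, List.map_ofFn, List.sum_ofFn] at h
  have hk : Fintype.card (Fin M.k) < B := by
    have := M.length_components_le
    simp only [components, List.length_ofFn] at this
    simpa using this.trans_lt hB
  obtain ⟨π, hπ⟩ := exists_perm_of_sum_pow_eq hk h
  have hval : ∀ l j, y (M.component l j) = y' (M.component (π l) j) := by
    intro l j
    have := code_injective (y := y) (y' := y') (by simp) (hπ l).symm
    rw [List.map_ofFn, List.map_ofFn, List.ofFn_inj] at this
    exact congrFun this j
  have hsome : ∀ l j, (y' (M.component l j)).isSome := fun l j =>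
    (hy' _).2 ((M.mem_Y_iff _).2 ⟨l, j, rfl⟩)
  have hnone : ∀ {y : PartialAssignment M.n d}, y.IsAssignmentOf M.Y → ∀ j ∉ M.Y, y j = none :=
    fun {y} hy j hj => by simpa using mt (hy j).1 hj
  rw [marginal_eq_pr (a := fun l j => (y' (M.component l j)).get (hsome l j)) (hnone hy')
      fun l j => by simp,
    H π, ← marginal_eq_pr (hnone hy) fun l j => by rw [hval]; simp]

theorem marginal_nonneg [IsStrictOrderedRing K] (e : PartialAssignment M.n d) :
    0 ≤ M.marginal e :=
  Finset.sum_nonneg fun x _ => M.prob_mem.1 x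

/-- The law of total probability, conditioning on the variable `j`; it is the hypothesis `hμ` of
`sum_full`. -/
theorem sum_marginal_update (y : PartialAssignment M.n d) (j : Fin M.n) (hj : y j = none) :
    ∑ v, M.marginal (Function.update y j (some v)) = M.marginal y := by
  classical
  simp only [marginal, pr]
  rw [← Finset.sum_fiberwise _ fun x : Fin M.n → Fin d => x j]
  refine Finset.sum_congr rfl fun v _ => Finset.sum_congr ?_ fun _ _ => rfl
  ext x
  simp only [Finset.mem_filter, Finset.mem_univ, true_and, Set.mem_ofPred_eq]
  refine ⟨fun h => ⟨fun i w hw => h i w ?_, h j v (Function.update_self ..)⟩, ?_⟩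
  · rwa [Function.update_of_ne]
    rintro rfl
    simp [hj] at hw
  · rintro ⟨h, rfl⟩ i w hw
    by_cases hi : i = j
    · subst hi
      simpa using hw
    · exact h i w (by rwa [Function.update_of_ne hi] at hw)

end Model

/-! ## Inference over exchangeable decompositions -/

namespace Model

open PartialAssignment TableEntry

variable {K : Type*} [Field K] [LinearOrder K] {d W : ℕ} {F : Set (Model K d)}

theorem encodeDecomposition_eq (M : Model K d) : M.encodeDecomposition =
    .ofList (M.components.map fun c => .ofList (c.map fun j => .unary j.val)) := by
  simp [encodeDecomposition, components, List.map_ofFn, Function.comp_def]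

/-- The table of the dynamic program for a model and evidence. -/
def classTable (M : Model K d) (e : PartialAssignment M.n d) : List (TableEntry M.n d) :=
  table (M.n + 1) e M.components

section Correctness

variable {M : Model K d} {e : PartialAssignment M.n d}

theorem completes_iff (he : e.IsEvidenceOn M.Y) {y : PartialAssignment M.n d} :
    Completes e M.components.flatten y ↔ y.IsAssignmentOf M.Y ∧ y.Extends e := by
  simp only [Completes, mem_flatten_components, mem_options]
  refine ⟨fun h => ⟨fun j => ⟨fun hj => ?_, fun hj => ?_⟩, fun j v hv => ?_⟩,
    fun h j => ⟨fun hj => ?_, fun hj => ?_⟩⟩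
  · by_contra hjY
    rw [(h j).1 hjY] at hj
    exact hjY (he j hj)
  · obtain ⟨v, -, hv⟩ := (h j).2 hj
    simp [hv]
  · obtain ⟨w, hw, hy⟩ := (h j).2 (he j (by simp [hv]))
    rw [hy, hw v hv]
  · have h1 : y j = none := by simpa using mt (h.1 j).1 hj
    have h2 : e j = none := by simpa using mt (he j) hj
    rw [h1, h2]
  · obtain ⟨v, hv⟩ := Option.isSome_iff_exists.1 ((h.1 j).2 hj)
    exact ⟨v, fun w hw => Option.some_injective _ (hv.symm.trans (h.2 j w hw)), hv⟩

theorem represents_classTable {x : TableEntry M.n d} (hx : x ∈ M.classTable e) :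
    Represents (M.n + 1) e M.components [] x :=
  represents_table M.nodup_flatten_components x hx

theorem asg_of_represents (he : e.IsEvidenceOn M.Y) {x : TableEntry M.n d}
    (hx : Represents (M.n + 1) e M.components [] x) :
    x.asg.IsAssignmentOf M.Y ∧ x.asg.Extends e :=
  (completes_iff he).1 (by simpa using hx.completes)

theorem marginal_eq_of_key_eq (H : M.MarginallyExchangeable) (he : e.IsEvidenceOn M.Y)
    {x x' : TableEntry M.n d} (hx : Represents (M.n + 1) e M.components [] x)
    (hx' : Represents (M.n + 1) e M.components [] x') (h : x.key = x'.key) :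
    M.marginal x.asg = M.marginal x'.asg :=
  H.marginal_eq (asg_of_represents he hx).1 (asg_of_represents he hx').1 (Nat.lt_succ_self _)
    (hx.key.symm.trans (h.trans hx'.key))

theorem weightedSum_classTable (H : M.MarginallyExchangeable) (he : e.IsEvidenceOn M.Y) :
    weightedSum M.marginal (M.classTable e) = M.marginal e := by
  classical
  have hfull := represents_full (B := M.n + 1) (e := e) M.nodup_flatten_components
  -- The probability as a function of the key: any representative may be chosen, by exchangeability.
  -- The value `0` at keys that do not occur is irrelevant.
  let G : ℕ → ℕ → K := fun k _ =>
    if h : ∃ x, Represents (M.n + 1) e M.components [] x ∧ x.key = k then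
      M.marginal h.choose.asg else 0
  have hG : ∀ x, Represents (M.n + 1) e M.components [] x → G x.key x.t = M.marginal x.asg := by
    intro x hx
    have h : ∃ x', Represents (M.n + 1) e M.components [] x' ∧ x'.key = x.key := ⟨x, hx, rfl⟩
    simp only [G, dif_pos h]
    exact marginal_eq_of_key_eq H he h.choose_spec.1 hx h.choose_spec.2
  rw [weightedSum_eq, ← sum_full (B := M.n + 1) sum_marginal_update M.nodup_flatten_components]
  refine Eq.trans ?_ ((tableSum_table (B := M.n + 1) (e := e) M.components G).trans ?_)
  · exact congrArg List.sum (List.map_congr_left fun x hx => by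
      rw [hG x (represents_classTable hx)])
  · exact congrArg List.sum (List.map_congr_left fun x hx => by
      rw [hG x (hfull x hx), cnt_full _ x hx, one_smul])

theorem exists_mem_classTable (H : M.MarginallyExchangeable) (he : e.IsEvidenceOn M.Y)
    {y : PartialAssignment M.n d} (hy : y.IsAssignmentOf M.Y) (hye : y.Extends e) :
    ∃ x ∈ M.classTable e, M.marginal x.asg = M.marginal y := by
  have hnd := M.nodup_flatten_components
  obtain ⟨x, hx, rfl⟩ := exists_mem_full (B := M.n + 1) hnd ((completes_iff he).2 ⟨hy, hye⟩)
  obtain ⟨s, hs, hsx⟩ := exists_mem_table hx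
  exact ⟨s, hs, marginal_eq_of_key_eq H he (represents_classTable hs)
    (represents_full hnd x hx) hsx⟩

theorem exists_extends (he : e.IsEvidenceOn M.Y) :
    ∃ y : PartialAssignment M.n d, y.IsAssignmentOf M.Y ∧ y.Extends e := by
  classical
  -- The probabilities sum to one, so some full assignment exists; its values fill the gaps in the
  -- evidence.
  obtain ⟨x⟩ : Nonempty (Fin M.n → Fin d) := by
    by_contra h
    rw [not_nonempty_iff] at h
    have := M.prob_mem.2
    simp at this
  refine ⟨fun j => if j ∈ M.Y then some ((e j).getD (x j)) else none, fun j => ?_,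
    fun j v hv => ?_⟩
  · by_cases hj : j ∈ M.Y <;> simp [hj]
  · simp [he j (by simp [hv]), hv]

theorem isMPE_best [IsStrictOrderedRing K] (H : M.MarginallyExchangeable)
    (he : e.IsEvidenceOn M.Y) : M.IsMPE e (best M.marginal e (M.classTable e)).2 := by
  obtain ⟨y, hy, hye⟩ := exists_extends he
  obtain ⟨x, hx, -⟩ := exists_mem_classTable H he hy hye
  rcases best_spec marginal_nonneg e (M.classTable e) with ⟨h, -⟩ | ⟨⟨x, hx, hb⟩, hle⟩
  · simp [h] at hx
  · rw [hb] at hle ⊢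
    obtain ⟨h1, h2⟩ := asg_of_represents he (represents_classTable hx)
    refine ⟨h1, h2, fun y' hy' hye' => ?_⟩
    obtain ⟨x', hx', h⟩ := exists_mem_classTable H he hy' hye'
    exact h ▸ hle x' hx'

end Correctness

/-! ### Running time on the instances of `F`. -/

section Time

/-- The problem instances: a model with evidence. -/
def Instance (F : Set (Model K d)) : Type _ :=
  {q : Σ M : Model K d, PartialAssignment M.n d // q.1 ∈ F ∧ q.2.IsEvidenceOn q.1.Y}

namespace Instance

/-- The model of a problem instance. -/
def model (q : Instance F) : Model K d := q.1.1

/-- The evidence of a problem instance. -/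
def evidence (q : Instance F) : PartialAssignment q.model.n d := q.1.2

/-- The number of variables. -/
def numVars (q : Instance F) : ℕ := q.model.n

/-- The input of a program. -/
def input (q : Instance F) : Val K := q.model.input q.evidence

/-- The table of the dynamic program. -/
def table (q : Instance F) : List (TableEntry q.numVars d) := q.model.classTable q.evidence

theorem polyBdd_size : PolyBdd (numVars (F := F)) fun q => Nat.size (q.numVars + 1) :=
  (PolyBdd.self.add (.const 1)).mono fun _ => Nat.size_le_self _

theorem length_le_of_mem_components (hwidth : ∀ M ∈ F, M.width ≤ W) (q : Instance F) :
    ∀ c ∈ q.model.components, c.length ≤ W := by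
  intro c hc
  obtain ⟨l, rfl⟩ := (List.mem_ofFn' _ _).1 hc
  simpa using hwidth q.model q.2.1

/-- Stated for arbitrary prefixes of the list of components, because the intermediate tables of the
loop need the bound as well as the final one. -/
theorem small_pre (hwidth : ∀ M ∈ F, M.width ≤ W) {J : Type*} (φ : J → Instance F)
    (pre : ∀ j, List (List (Fin (φ j).numVars))) (hpre : ∀ j, pre j <+: (φ j).model.components) :
    Small (fun j => (φ j).numVars) fun j =>
      TableEntry.table ((φ j).numVars + 1) (φ j).evidence (pre j) := by
  have hflat : ∀ j, (pre j).flatten.Sublist (φ j).model.components.flatten :=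
    fun j => (hpre j).sublist.flatten
  have hnd : ∀ j, (pre j).flatten.Nodup :=
    fun j => (nodup_flatten_components _).sublist (hflat j)
  have hW : ∀ j, ∀ c ∈ pre j, c.length ≤ W := fun j c hc =>
    length_le_of_mem_components hwidth (φ j) c ((hpre j).subset hc)
  have hN := (PolyBdd.self (N := numVars (F := F))).reindex φ
  have hlen : PolyBdd (fun j => (φ j).numVars) fun j => (pre j).length :=
    hN.mono fun j => (hpre j).length_le.trans (length_components_le _)
  have hflen : PolyBdd (fun j => (φ j).numVars) fun j => (pre j).flatten.length :=
    hN.mono fun j => by simpa using (hnd j).length_le_card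
  have h1 := (hlen.mul ((hN.add (.const 1)).pow ((d + 1) ^ W))).add (.const 1)
  have h2 := ((hlen.add (((PolyBdd.const ((d + 1) ^ W)).mul
    (polyBdd_size.reindex φ)).add (.const 1))).add (.const 1)).add
    ((hflen.mul (.const (Nat.size (d + 1)))).add (.const 1))
  refine ⟨_, h1.add h2, fun j => ⟨?_, fun x hx => ?_⟩⟩
  · exact (length_table_le (hnd j) (Nat.succ_pos _) (hW j)).trans (Nat.le_add_right _ _)
  · exact (size_table_le (hnd j) (Nat.succ_pos _) (hW j) hx).trans (Nat.le_add_left _ _)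

theorem small_table (hwidth : ∀ M ∈ F, M.width ≤ W) : Small (numVars (F := F)) table :=
  small_pre hwidth id _ fun _ => List.prefix_rfl

variable (h : HeightFn K) (F)

theorem polyTime_description :
    PolyTime h (numVars (F := F)) input fun q =>
      .cons q.model.desc q.model.encodeDecomposition :=
  PolyTime.fst (b := fun q => q.evidence.encode) (.refl (.const 0)) (.const 0)

theorem polyTime_evidence :
    PolyTime h (numVars (F := F)) input fun q => q.evidence.encode :=
  PolyTime.snd (a := fun q => .cons q.model.desc q.model.encodeDecomposition) (.refl (.const 0))
    (by simpa using PolyBdd.const 0)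

/-- The base `n + 1` is not part of the input; it is computed by counting the entries of the
evidence. -/
theorem polyTime_numVars_succ : PolyTime h (numVars (F := F)) input fun q =>
    .num ((q.numVars + 1 : ℕ) : K) := by
  have hN : PolyTime h (numVars (F := F)) input fun q => .num (q.numVars : K) := by
    have := PolyTime.natCast_length (α := fun _ : Instance F => Option (Fin d))
      (l := fun q => List.ofFn q.evidence) (ea := fun _ => encodeEntry)
      (by simp only [List.map_ofFn]; exact polyTime_evidence F h)
      (PolyBdd.self.mono fun q => List.length_ofFn.le) (by simp)
    simp only [List.length_ofFn] at this
    exact this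
  simpa only [Nat.cast_succ] using hN.add (.one hN.height_left)

variable {F}

/-- The given program runs on the input with the evidence replaced by a representative, which
assigns all of `Y` as `hPr` requires. Its time bound also bounds the height of the result. -/
theorem polyTime_marginal
    (hPr : ∃ (P : Prog) (p : Polynomial ℕ), ∀ M ∈ F,
      ∀ y : PartialAssignment M.n d, y.IsAssignmentOf M.Y →
        RunsWithin h P (M.input y) (.num (M.marginal y)) (p.eval M.n)) :
    PolyTime h (I := Σ q : Instance F, {x // x ∈ q.table}) (fun q => q.1.numVars)
      (fun q => .cons (.cons q.1.model.desc q.1.model.encodeDecomposition) q.2.1.asg.encode)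
      fun q => .num (q.1.model.marginal q.2.1.asg) := by
  obtain ⟨P, p, hP⟩ := hPr
  have hT : PolyBdd (fun q : Σ q : Instance F, {x // x ∈ q.table} => q.1.numVars)
    fun q => p.eval q.1.numVars := ⟨p, fun _ => le_rfl⟩
  have hrun := fun q : Σ q : Instance F, {x // x ∈ q.table} => hP _ q.1.2.1 q.2.1.asg
    (asg_of_represents q.1.2.2 (represents_classTable q.2.2)).1
  exact ⟨.const 0, hT.mono fun q => (hrun q).height_le.trans (by simp [Model.input, numVars, model]), P, _, hT,
    hrun⟩

variable [IsStrictOrderedRing K]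

theorem polyTime_table (hwidth : ∀ M ∈ F, M.width ≤ W) :
    PolyTime h (numVars (F := F)) input fun q => encodeTable q.table := by
  refine PolyTime.table (B := fun q => q.numVars + 1) (e := evidence)
    (cs := fun q => q.model.components) (polyTime_evidence F h) (polyTime_numVars_succ F h)
    polyBdd_size ?_ (PolyBdd.self.mono fun q => length_components_le _)
    (length_le_of_mem_components hwidth) (small_pre hwidth _ _ Split.prefix)
  have := polyTime_description F h
  simp only [encodeDecomposition_eq] at this
  exact this.snd (by simpa using PolyBdd.const 0)

end Instance

theorem exists_prog_of_polyTime {h : HeightFn K}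
    {r : ∀ M : Model K d, PartialAssignment M.n d → Val K}
    (H : PolyTime h (Instance.numVars (F := F)) Instance.input
      fun q => r q.model q.evidence) :
    ∃ (P : Prog) (p : Polynomial ℕ), ∀ M ∈ F, ∀ e : PartialAssignment M.n d,
      e.IsEvidenceOn M.Y → RunsWithin h P (M.input e) (r M e) (p.eval M.n) := by
  obtain ⟨-, -, P, T, ⟨p, hp⟩, hr⟩ := H
  exact ⟨P, p, fun M hM e he => (hr ⟨⟨M, e⟩, hM, he⟩).mono (hp ⟨⟨M, e⟩, hM, he⟩)⟩

end Time

end Model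

theorem mainTheorem4 {K : Type*} [Field K] [LinearOrder K] [IsStrictOrderedRing K]
    (h : HeightFn K) (d W : ℕ) (F : Set (Model K d))
    (hexch : ∀ M ∈ F, M.MarginallyExchangeable)
    (hwidth : ∀ M ∈ F, M.width ≤ W)
    (hPr : ∃ (P : Prog) (p : Polynomial ℕ), ∀ M ∈ F,
      ∀ y : PartialAssignment M.n d, y.IsAssignmentOf M.Y →
        RunsWithin h P (M.input y) (.num (M.marginal y)) (p.eval M.n)) :
    (∃ (P : Prog) (p : Polynomial ℕ), ∀ M ∈ F,
      ∀ e : PartialAssignment M.n d, e.IsEvidenceOn M.Y →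
        ∃ y : PartialAssignment M.n d, M.IsMPE e y ∧
          RunsWithin h P (M.input e) y.encode (p.eval M.n)) ∧
    (∃ (P : Prog) (p : Polynomial ℕ), ∀ M ∈ F,
      ∀ e : PartialAssignment M.n d, e.IsEvidenceOn M.Y →
        RunsWithin h P (M.input e) (.num (M.marginal e)) (p.eval M.n)) := by
  have htab := Model.Instance.polyTime_table h hwidth
  have hsmall := Model.Instance.small_table hwidth
  have hdesc := Model.Instance.polyTime_description F h
  have hmarg := Model.Instance.polyTime_marginal h hPr
  constructor
  · obtain ⟨P, p, hP⟩ := Model.exists_prog_of_polyTime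
      (r := fun M e => (TableEntry.best M.marginal e (M.classTable e)).2.encode)
      (PolyTime.best (fun _ => Model.marginal_nonneg) htab hsmall hdesc
        (Model.Instance.polyTime_evidence F h) hmarg)
    exact ⟨P, p, fun M hM e he => ⟨_, Model.isMPE_best (hexch M hM) he, hP M hM e he⟩⟩
  · obtain ⟨P, p, hP⟩ := Model.exists_prog_of_polyTime
      (r := fun M e => .num (TableEntry.weightedSum M.marginal (M.classTable e)))
      (PolyTime.weightedSum htab hsmall hdesc hmarg)
    exact ⟨P, p, fun M hM e he =>
      Model.weightedSum_classTable (hexch M hM) he ▸ hP M hM e he⟩
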